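/- Let $k$ be a field and let $A$ be a DG Hopf algebra over $k$: a DG $k$-algebra $A$ (homologically graded, with differential of degree $-1$) with $A_i=0$ for $i<0$ and $A_0=k$, together with a morphism of DG $k$-algebras $\Delta\colon A\to A\otimes_k A$ satisfying $(\varepsilon\otimes A)\Delta=\mathrm{id}_A=(A\otimes\varepsilon)\Delta$, where $\varepsilon\colon A\to A_0=k$ is the canonical surjection and $A\otimes_kA$ has the product $(a\otimes b)(a'\otimes b')=(-1)^{|b||a'|}aa'\otimes bb'$. Let $U,V$ be (left) DG $A$-modules. For a semifree resolution $F\to U$ put $\operatorname{Ext}^i_A(U,V)=H^i(\operatorname{Hom}_A(F,V))$; composition products make $\operatorname{Ext}_A(U,U)$ a graded algebra and $\operatorname{Ext}_A(U,V)$ a graded $\operatorname{Ext}_A(V,V)$-$\operatorname{Ext}_A(U,U)$-bimodule. Put $S=\operatorname{Ext}_A(k,k)$. Choose semifree resolutions $F\to k$ and $G\to V$ and let $A$ act on $F\otimes_kG$ through $\Delta$. The assignment $\psi\mapsto\psi\otimes_kG$ from $\operatorname{Hom}_A(F,F)$ to $\operatorname{Hom}_A(F\otimes_kG,F\otimes_kG)$,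 together with the homotopy equivalence $F\otimes_kG\to k\otimes_kG\cong G$, induces in homology a homomorphism of graded $k$-algebras $\zeta_V\colon S\to\operatorname{Ext}_A(V,V)$; let $\zeta_U$ be defined in the same way. Then, for all choices of the resolutions: 1. $S$ is graded-commutative: $\sigma\tau=(-1)^{|\sigma||\tau|}\tau\sigma$ for all homogeneous $\sigma,\tau\in S$. 2. $\zeta_V(S)$ is contained in the graded center of $\operatorname{Ext}_A(V,V)$: $b\,\zeta_V(\sigma)=(-1)^{|b||\sigma|}\zeta_V(\sigma)\,b$ for all homogeneous $\sigma\in S$ and $b\in\operatorname{Ext}_A(V,V)$. 3. The left $S$-module structures on $\operatorname{Ext}_A(U,V)$ induced via $\zeta_V$ and via $\zeta_U$ coincide: $\zeta_V(\sigma)\,\mu=(-1)^{|\sigma||\mu|}\mu\,\zeta_U(\sigma)$ for all homogeneous $\sigma\in S$ and $\mu\in\operatorname{Ext}_A(U,V)$. -/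

import Mathlib

universe u v w w' w'' x₁ x₂ x₃ x₄ y₁ y₂ y₃

open scoped TensorProduct

noncomputable section

namespace DG

/-! ### Graded vector spaces -/

section Graded

variable {k : Type u} [Field k] {M : Type v} [AddCommGroup M] [Module k M]
  {N : Type w} [AddCommGroup N] [Module k N] {Q : Type w'} [AddCommMonoid Q] [Module k Q]
  {gr : ℤ → Submodule k M}

/-- The linear map on `M = ⨁ gr i` which agrees with `f i` on `gr i`. -/
def grLift (h : DirectSum.IsInternal gr) (f : ℤ → M →ₗ[k] Q) : M →ₗ[k] Q :=
  (DirectSum.toModule k ℤ Q (fun i => f i ∘ₗ (gr i).subtype)) ∘ₗ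
    ((LinearEquiv.ofBijective (DirectSum.coeLinearMap gr) h).symm : M →ₗ[k] _)

theorem grLift_apply (h : DirectSum.IsInternal gr) (f : ℤ → M →ₗ[k] Q) {i : ℤ} {x : M}
    (hx : x ∈ gr i) : grLift h f x = f i x := by
  have : (LinearEquiv.ofBijective (DirectSum.coeLinearMap gr) h).symm x
      = DirectSum.lof k ℤ (fun i => gr i) i ⟨x, hx⟩ := by
    rw [LinearEquiv.symm_apply_eq]
    exact (DirectSum.coeLinearMap_lof gr i ⟨x, hx⟩).symm
  simp [grLift, this]

theorem gr_ext (h : DirectSum.IsInternal gr) {f g : M →ₗ[k] Q}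
    (H : ∀ i, ∀ x ∈ gr i, f x = g x) : f = g := by
  ext x
  have hx : x ∈ ⨆ i, gr i := by rw [h.submodule_iSup_eq_top]; trivial
  induction hx using Submodule.iSup_induction' with
  | mem i x hx => exact H i x hx
  | zero => simp
  | add x y _ _ hx hy => simp [hx, hy]

/-- The operator `x ↦ (-1)^(n * |x|) x`. -/
def sgnMap (h : DirectSum.IsInternal gr) (n : ℤ) : M →ₗ[k] M :=
  grLift h (fun i => ((-1 : k) ^ (n * i)) • LinearMap.id)

theorem sgnMap_apply (h : DirectSum.IsInternal gr) (n : ℤ) {i : ℤ} {x : M} (hx : x ∈ gr i) :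
    sgnMap h n x = (-1 : k) ^ (n * i) • x := by
  simp [sgnMap, grLift_apply h _ hx]

/-- The projection onto the component of degree `n`. -/
def grProj (h : DirectSum.IsInternal gr) (n : ℤ) : M →ₗ[k] M :=
  grLift h (fun i => if i = n then LinearMap.id else 0)

theorem grProj_same (h : DirectSum.IsInternal gr) {n : ℤ} {x : M} (hx : x ∈ gr n) :
    grProj h n x = x := by
  simp [grProj, grLift_apply h _ hx]

theorem grProj_ne (h : DirectSum.IsInternal gr) {n i : ℤ} {x : M} (hx : x ∈ gr i) (hi : i ≠ n) :
    grProj h n x = 0 := by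
  simp [grProj, grLift_apply h _ hx, hi]

theorem grProj_mem (h : DirectSum.IsInternal gr) (n : ℤ) (x : M) : grProj h n x ∈ gr n := by
  have hx : x ∈ ⨆ i, gr i := by rw [h.submodule_iSup_eq_top]; trivial
  induction hx using Submodule.iSup_induction' with
  | mem i x hx =>
    by_cases hi : i = n
    · subst hi; rw [grProj_same h hx]; exact hx
    · rw [grProj_ne h hx hi]; exact zero_mem _
  | zero => simp
  | add x y _ _ hx hy => rw [map_add]; exact add_mem hx hy

theorem neg_one_zpow_add (k : Type u) [Field k] (m n : ℤ) :
    (-1 : k) ^ (m + n) = (-1) ^ m * (-1) ^ n :=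
  zpow_add₀ (by simp) m n

theorem neg_one_zpow_mul_self (k : Type u) [Field k] (m : ℤ) :
    (-1 : k) ^ m * (-1) ^ m = 1 := by
  rw [← neg_one_zpow_add]; exact Even.neg_one_zpow ⟨m, rfl⟩

theorem neg_one_zpow_sub_one (k : Type u) [Field k] (m : ℤ) :
    (-1 : k) ^ (m - 1) = - (-1) ^ m := by
  rw [zpow_sub_one₀ (by simp)]; simp [inv_neg]

theorem neg_one_zpow_add_one (k : Type u) [Field k] (m : ℤ) :
    (-1 : k) ^ (m + 1) = - (-1) ^ m := by
  rw [zpow_add_one₀ (by simp)]; simp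

/-- The grading on a tensor product: degree `n` is spanned by the `x ⊗ y` with `|x| + |y| = n`. -/
def tensorGr (gr : ℤ → Submodule k M) (gr' : ℤ → Submodule k N) (n : ℤ) :
    Submodule k (M ⊗[k] N) :=
  Submodule.span k {t | ∃ i j x y, i + j = n ∧ x ∈ gr i ∧ y ∈ gr' j ∧ t = x ⊗ₜ[k] y}

theorem tmul_mem_tensorGr {gr' : ℤ → Submodule k N} {i j n : ℤ} {x : M} {y : N}
    (hn : i + j = n) (hx : x ∈ gr i) (hy : y ∈ gr' j) : x ⊗ₜ[k] y ∈ tensorGr gr gr' n :=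
  Submodule.subset_span ⟨i, j, x, y, hn, hx, hy, rfl⟩

theorem tensor_ext {gr' : ℤ → Submodule k N}
    (h : DirectSum.IsInternal gr) (h' : DirectSum.IsInternal gr') {f g : M ⊗[k] N →ₗ[k] Q}
    (H : ∀ i j, ∀ x ∈ gr i, ∀ y ∈ gr' j, f (x ⊗ₜ y) = g (x ⊗ₜ y)) : f = g := by
  apply TensorProduct.ext
  refine gr_ext h fun i x hx => gr_ext h' fun j y hy => ?_
  simpa using H i j x hx y hy

theorem tensorGr_isInternal {gr' : ℤ → Submodule k N}
    (h : DirectSum.IsInternal gr) (h' : DirectSum.IsInternal gr') :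
    DirectSum.IsInternal (tensorGr gr gr') := by
  classical
  -- the homogeneous components, as a map to the direct sum
  let c : ∀ i j : ℤ, (gr i) →ₗ[k] (gr' j) →ₗ[k] (DirectSum ℤ fun n => tensorGr gr gr' n) :=
    fun i j => LinearMap.mk₂ k
      (fun x y => DirectSum.lof k ℤ (fun n => tensorGr gr gr' n) (i + j)
        ⟨x.1 ⊗ₜ y.1, tmul_mem_tensorGr rfl x.2 y.2⟩)
      (fun x x' y => by
        rw [← map_add]; congr 1; ext; simp [TensorProduct.add_tmul])
      (fun a x y => by
        rw [← map_smul]; congr 1)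
      (fun x y y' => by
        rw [← map_add]; congr 1; ext; simp [TensorProduct.tmul_add])
      (fun a x y => by
        rw [← map_smul]; congr 1; ext; simp)
  let cp : ∀ i : ℤ, M →ₗ[k] gr i := fun i => (grProj h i).codRestrict _ (grProj_mem h i)
  let cp' : ∀ i : ℤ, N →ₗ[k] gr' i := fun i => (grProj h' i).codRestrict _ (grProj_mem h' i)
  let F : M →ₗ[k] N →ₗ[k] (DirectSum ℤ fun n => tensorGr gr gr' n) :=
    grLift h (fun i => (LinearMap.flip
      (grLift h' (fun j => ((c i j).compl₁₂ (cp i) (cp' j)).flip))))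
  have hF : ∀ i j, ∀ x (hx : x ∈ gr i), ∀ y (hy : y ∈ gr' j), F x y =
      DirectSum.lof k ℤ (fun n => tensorGr gr gr' n) (i + j)
        ⟨x ⊗ₜ y, tmul_mem_tensorGr rfl hx hy⟩ := by
    intro i j x hx y hy
    simp only [F]
    rw [grLift_apply h _ hx, LinearMap.flip_apply, grLift_apply h' _ hy]
    have e1 : cp i x = ⟨x, hx⟩ := Subtype.ext (grProj_same h hx)
    have e2 : cp' j y = ⟨y, hy⟩ := Subtype.ext (grProj_same h' hy)
    simp [c, e1, e2]
  have D : DirectSum.Decomposition (tensorGr gr gr') :=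
    DirectSum.Decomposition.ofLinearMap _ (TensorProduct.lift F)
      (by
        refine tensor_ext h h' fun i j x hx y hy => ?_
        simp [hF i j x hx y hy])
      (by
        refine DirectSum.linearMap_ext _ fun n => ?_
        apply LinearMap.ext
        rintro ⟨t, ht⟩
        simp only [LinearMap.comp_apply, DirectSum.coeLinearMap_lof, LinearMap.id_apply]
        induction ht using Submodule.span_induction with
        | mem t ht =>
          obtain ⟨i, j, x, y, rfl, hx, hy, rfl⟩ := ht
          simp [hF i j x hx y hy]
        | zero =>
          rw [map_zero]; symm; exact map_zero _
        | add s t hs ht h1 h2 =>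
          rw [map_add, h1, h2, ← map_add]; rfl
        | smul a t ht h1 =>
          rw [map_smul, h1, ← map_smul]; rfl)
  exact DirectSum.Decomposition.isInternal _

/-- The tensor product differential `d(x ⊗ y) = dx ⊗ y + (-1)^|x| x ⊗ dy`. -/
def tensorD (h : DirectSum.IsInternal gr) (d : M →ₗ[k] M) (d' : N →ₗ[k] N) :
    M ⊗[k] N →ₗ[k] M ⊗[k] N :=
  TensorProduct.map d LinearMap.id + TensorProduct.map (sgnMap h 1) d'

theorem tensorD_tmul (h : DirectSum.IsInternal gr) (d : M →ₗ[k] M) (d' : N →ₗ[k] N)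
    {i : ℤ} {x : M} (hx : x ∈ gr i) (y : N) :
    tensorD h d d' (x ⊗ₜ y) = d x ⊗ₜ y + (-1 : k) ^ i • (x ⊗ₜ d' y) := by
  simp [tensorD, sgnMap_apply h 1 hx, TensorProduct.smul_tmul']

end Graded

/-! ### DG algebras and DG modules -/

/-- A (homologically graded) DG algebra over the field `k`: the differential has degree `-1`. -/
structure DGAlgebra (k : Type u) [Field k] where
  carrier : Type v
  [ring : Ring carrier]
  [algebra : Algebra k carrier]
  gr : ℤ → Submodule k carrier
  [graded : GradedAlgebra gr]
  d : carrier →ₗ[k] carrier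
  d_mem : ∀ {i : ℤ} {a : carrier}, a ∈ gr i → d a ∈ gr (i - 1)
  d_d : ∀ a, d (d a) = 0
  d_mul : ∀ {i : ℤ} {a : carrier}, a ∈ gr i → ∀ b, d (a * b) = d a * b + (-1 : k) ^ i • (a * d b)

instance {k : Type u} [Field k] : CoeSort (DGAlgebra.{u, v} k) (Type v) := ⟨DGAlgebra.carrier⟩

attribute [instance] DGAlgebra.ring DGAlgebra.algebra DGAlgebra.graded

/-- A left DG module over the DG algebra `A`. -/
structure DGModule {k : Type u} [Field k] (A : DGAlgebra.{u, v} k) where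
  carrier : Type w
  [addCommGroup : AddCommGroup carrier]
  [moduleBase : Module k carrier]
  [module : Module A carrier]
  [isScalarTower : IsScalarTower k A carrier]
  gr : ℤ → Submodule k carrier
  isInternal : DirectSum.IsInternal gr
  smul_mem : ∀ {i j : ℤ} {a : A} {x : carrier}, a ∈ A.gr i → x ∈ gr j → a • x ∈ gr (i + j)
  d : carrier →ₗ[k] carrier
  d_mem : ∀ {i : ℤ} {x : carrier}, x ∈ gr i → d x ∈ gr (i - 1)
  d_d : ∀ x, d (d x) = 0
  d_smul : ∀ {i : ℤ} {a : A}, a ∈ A.gr i → ∀ x : carrier,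
    d (a • x) = A.d a • x + (-1 : k) ^ i • (a • d x)

instance {k : Type u} [Field k] {A : DGAlgebra.{u, v} k} :
    CoeSort (DGModule.{u, v, w} A) (Type w) := ⟨DGModule.carrier⟩

attribute [instance] DGModule.addCommGroup DGModule.moduleBase DGModule.module
  DGModule.isScalarTower

section Basics

variable {k : Type u} [Field k]

theorem DGAlgebra.isInternal (A : DGAlgebra.{u, v} k) : DirectSum.IsInternal A.gr :=
  DirectSum.Decomposition.isInternal A.gr

/-- `A` is non-negative and `A₀ = k`. -/
structure DGAlgebra.IsConnected (A : DGAlgebra.{u, v} k) : Prop where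
  gr_neg : ∀ i : ℤ, i < 0 → A.gr i = ⊥
  gr_zero : A.gr 0 = LinearMap.range (Algebra.linearMap k A)
  algebraMap_injective : Function.Injective (algebraMap k A)

variable {A : DGAlgebra.{u, v} k}

theorem DGAlgebra.IsConnected.exists_scalar (hA : A.IsConnected) (a : A) :
    ∃ c : k, algebraMap k A c = grProj A.isInternal 0 a := by
  have := grProj_mem A.isInternal 0 a
  rw [hA.gr_zero] at this
  exact this

theorem DGAlgebra.one_mem (A : DGAlgebra.{u, v} k) : (1 : A) ∈ A.gr 0 := SetLike.GradedOne.one_mem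

theorem DGAlgebra.mul_mem (A : DGAlgebra.{u, v} k) {i j : ℤ} {a b : A} (ha : a ∈ A.gr i)
    (hb : b ∈ A.gr j) : a * b ∈ A.gr (i + j) := SetLike.GradedMul.mul_mem ha hb

theorem DGAlgebra.algebraMap_mem (A : DGAlgebra.{u, v} k) (c : k) : algebraMap k A c ∈ A.gr 0 := by
  rw [Algebra.algebraMap_eq_smul_one]; exact Submodule.smul_mem _ _ A.one_mem

theorem DGAlgebra.IsConnected.grProj_mul (hA : A.IsConnected) (a b : A) :
    grProj A.isInternal 0 (a * b) = grProj A.isInternal 0 a * grProj A.isInternal 0 b := by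
  have key : (LinearMap.mul k A).compr₂ (grProj A.isInternal 0) =
      (LinearMap.mul k A).compl₁₂ (grProj A.isInternal 0) (grProj A.isInternal 0) := by
    refine gr_ext A.isInternal fun i a ha => gr_ext A.isInternal fun j b hb => ?_
    simp only [LinearMap.compr₂_apply, LinearMap.mul_apply', LinearMap.compl₁₂_apply]
    rcases lt_trichotomy i 0 with hi | rfl | hi
    · rw [hA.gr_neg i hi, Submodule.mem_bot] at ha
      simp [ha]
    · rcases eq_or_ne j 0 with rfl | hj
      · rw [grProj_same _ ha, grProj_same _ hb, grProj_same _ (by simpa using A.mul_mem ha hb)]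
      · rw [grProj_ne _ hb hj, grProj_ne _ (A.mul_mem ha hb) (by simpa using hj), mul_zero]
    · rw [grProj_ne _ ha hi.ne', zero_mul]
      rcases lt_or_ge j 0 with hj | hj
      · rw [hA.gr_neg j hj, Submodule.mem_bot] at hb
        simp [hb]
      · rw [grProj_ne _ (A.mul_mem ha hb) (by omega)]
  exact LinearMap.congr_fun₂ key a b

/-- The canonical surjection `ε : A → A₀ = k`. -/
def DGAlgebra.IsConnected.aug (hA : A.IsConnected) : A →ₐ[k] k where
  toFun a := (hA.exists_scalar a).choose
  map_one' := hA.algebraMap_injective (by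
    rw [(hA.exists_scalar 1).choose_spec, grProj_same _ A.one_mem, map_one])
  map_mul' a b := hA.algebraMap_injective ((hA.exists_scalar (a * b)).choose_spec.trans (by
    rw [hA.grProj_mul, map_mul, (hA.exists_scalar a).choose_spec,
      (hA.exists_scalar b).choose_spec]))
  map_zero' := hA.algebraMap_injective (by
    rw [(hA.exists_scalar _).choose_spec, map_zero, map_zero])
  map_add' a b := hA.algebraMap_injective ((hA.exists_scalar (a + b)).choose_spec.trans (by
    rw [map_add, map_add, (hA.exists_scalar a).choose_spec, (hA.exists_scalar b).choose_spec]))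
  commutes' c := hA.algebraMap_injective (by
    rw [(hA.exists_scalar _).choose_spec, grProj_same _ (A.algebraMap_mem c)]
    rfl)

theorem DGAlgebra.IsConnected.algebraMap_aug (hA : A.IsConnected) (a : A) :
    algebraMap k A (hA.aug a) = grProj A.isInternal 0 a := (hA.exists_scalar a).choose_spec

theorem DGAlgebra.IsConnected.aug_of_ne (hA : A.IsConnected) {i : ℤ} (hi : i ≠ 0) {a : A}
    (ha : a ∈ A.gr i) : hA.aug a = 0 :=
  hA.algebraMap_injective (by rw [hA.algebraMap_aug, grProj_ne _ ha hi, map_zero])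

end Basics

/-- A DG Hopf algebra over the field `k`: a non-negative DG algebra `A` with `A₀ = k` and a morphism
`Δ : A → A ⊗ A` of DG `k`-algebras such that `(ε ⊗ A)Δ = id = (A ⊗ ε)Δ`. Here `A ⊗ A` carries the
product `(a ⊗ b)(a' ⊗ b') = (-1)^(|b||a'|) aa' ⊗ bb'` of the graded tensor product.
Coassociativity is not required. -/
structure DGHopf (k : Type u) [Field k] extends DGAlgebra.{u, v} k where
  connected : toDGAlgebra.IsConnected
  comul : carrier →ₐ[k] GradedTensorProduct k gr gr
  comul_mem : ∀ {n : ℤ} {a : carrier}, a ∈ gr n →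
    (GradedTensorProduct.of k gr gr).symm (comul a) ∈ tensorGr gr gr n
  comul_d : ∀ a : carrier, (GradedTensorProduct.of k gr gr).symm (comul (d a)) =
    tensorD toDGAlgebra.isInternal d d ((GradedTensorProduct.of k gr gr).symm (comul a))
  aug_comul : ∀ a : carrier, TensorProduct.lid k carrier
    (TensorProduct.map connected.aug.toLinearMap LinearMap.id
      ((GradedTensorProduct.of k gr gr).symm (comul a))) = a
  comul_aug : ∀ a : carrier, TensorProduct.rid k carrier
    (TensorProduct.map LinearMap.id connected.aug.toLinearMap
      ((GradedTensorProduct.of k gr gr).symm (comul a))) = a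

section Hopf

variable {k : Type u} [Field k] (A : DGHopf.{u, v} k)

/-- The comultiplication as a linear map to the underlying tensor product. -/
def DGHopf.Δ : A.carrier →ₗ[k] A.carrier ⊗[k] A.carrier :=
  (GradedTensorProduct.of k A.gr A.gr).symm.toLinearMap ∘ₗ A.comul.toLinearMap

/-- The canonical surjection `ε : A → k`. -/
def DGHopf.ε : A.carrier →ₐ[k] k := A.connected.aug

theorem DGHopf.ε_of_ne {i : ℤ} (hi : i ≠ 0) {a : A.carrier} (ha : a ∈ A.gr i) : A.ε a = 0 :=
  A.connected.aug_of_ne hi ha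

/-- The augmentation of a DG Hopf algebra vanishes on boundaries. -/
theorem DGHopf.ε_d (a : A.carrier) : A.ε (A.d a) = 0 := by
  let e : A.carrier →ₗ[k] k := A.ε.toLinearMap
  have hs : e ∘ₗ sgnMap A.toDGAlgebra.isInternal 1 = e := by
    refine gr_ext A.toDGAlgebra.isInternal fun i x hx => ?_
    rw [LinearMap.comp_apply, sgnMap_apply _ _ hx]
    rcases eq_or_ne i 0 with rfl | hi
    · simp
    · have : e x = 0 := A.ε_of_ne hi hx
      simp [this]
  have h1 : ∀ t : A.carrier ⊗[k] A.carrier,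
      TensorProduct.lid k k (TensorProduct.map e e
        (tensorD A.toDGAlgebra.isInternal A.d A.d t)) =
      e (A.d (TensorProduct.rid k A.carrier (TensorProduct.map LinearMap.id e t))) +
      e (A.d (TensorProduct.lid k A.carrier (TensorProduct.map e LinearMap.id t))) := by
    intro t
    induction t with
    | zero => simp
    | tmul x y =>
      have : e (sgnMap A.toDGAlgebra.isInternal 1 x) = e x := LinearMap.congr_fun hs x
      simp [tensorD, this, mul_comm]
    | add s t hs ht => simp only [map_add, hs, ht]; abel
  have h2 : ∀ t : A.carrier ⊗[k] A.carrier, TensorProduct.lid k k (TensorProduct.map e e t) =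
      e (TensorProduct.lid k A.carrier (TensorProduct.map e LinearMap.id t)) := by
    intro t
    induction t with
    | zero => simp
    | tmul x y => simp
    | add s t hs ht => simp only [map_add, hs, ht]
  have h3 := h2 (A.Δ (A.d a))
  have h4 := h1 (A.Δ a)
  have e1 : TensorProduct.lid k A.carrier (TensorProduct.map e LinearMap.id (A.Δ (A.d a))) = A.d a :=
    A.aug_comul _
  have e2 : TensorProduct.lid k A.carrier (TensorProduct.map e LinearMap.id (A.Δ a)) = a :=
    A.aug_comul _
  have e3 : TensorProduct.rid k A.carrier (TensorProduct.map LinearMap.id e (A.Δ a)) = a :=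
    A.comul_aug _
  have e4 : A.Δ (A.d a) = tensorD A.toDGAlgebra.isInternal A.d A.d (A.Δ a) := A.comul_d a
  rw [e1, e4, h4, e2, e3] at h3
  have : e (A.d a) = 0 := by simpa using h3
  exact this

/-- The field `k` as a DG `A`-module, through `ε`, concentrated in degree `0`. -/
def DGHopf.trivial : DGModule.{u, v, u} A.toDGAlgebra :=
  letI : Module A.carrier k := Module.compHom k (A.ε : A.carrier →+* k)
  { carrier := k
    isScalarTower := ⟨fun c a x => by
      change A.ε (c • a) * x = c * (A.ε a * x)
      simp [mul_assoc]⟩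
    gr := fun i => if i = 0 then ⊤ else ⊥
    isInternal := by
      rw [DirectSum.isInternal_submodule_iff_iSupIndep_and_iSup_eq_top]
      constructor
      · rw [iSupIndep_def]
        intro i
        by_cases hi : i = 0
        · subst hi
          exact disjoint_bot_right.mono_right (iSup_le fun j => iSup_le fun hj => by simp [hj])
        · simp [hi]
      · refine eq_top_iff.2 (le_trans ?_ (le_iSup _ (0 : ℤ)))
        simp
    smul_mem := by
      intro i j a x ha hx
      change A.ε a * x ∈ _
      by_cases hj : j = 0
      · by_cases hi : i = 0
        · simp [hi, hj]
        · rw [A.ε_of_ne hi ha, zero_mul]; exact zero_mem _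
      · simp only [hj, if_false, Submodule.mem_bot] at hx
        rw [hx, mul_zero]; exact zero_mem _
    d := 0
    d_mem := by intro i x _; exact zero_mem _
    d_d := by intro x; rfl
    d_smul := by
      intro i a ha x
      change (0 : k) = A.ε (A.d a) * x + (-1 : k) ^ i • (A.ε a * 0)
      simp [A.ε_d] }

end Hopf

section Tensor

variable {k : Type u} [Field k]

section Action

variable {A : DGAlgebra.{u, v} k} (U : DGModule.{u, v, w} A) (V : DGModule.{u, v, w'} A)

/-- The action of `A ⊗ A` on `U ⊗ V`: `(a ⊗ b)(u ⊗ v) = (-1)^(|b||u|) au ⊗ bv`. -/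
def tensorAct : A.carrier ⊗[k] A.carrier →ₗ[k] Module.End k (U.carrier ⊗[k] V.carrier) :=
  TensorProduct.lift (LinearMap.flip (grLift A.isInternal (fun j =>
    ((TensorProduct.mapBilinear (RingHom.id k) U.carrier V.carrier U.carrier V.carrier).compl₁₂
      ((LinearMap.mulRight k (sgnMap U.isInternal j : Module.End k U.carrier)) ∘ₗ
        (Algebra.lsmul k k U.carrier : A →ₐ[k] Module.End k U.carrier).toLinearMap)
      (Algebra.lsmul k k V.carrier : A →ₐ[k] Module.End k V.carrier).toLinearMap).flip)))

theorem tensorAct_apply (a : A) {b : A} {j : ℤ} (hb : b ∈ A.gr j) {u : U} {i : ℤ}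
    (hu : u ∈ U.gr i) (v : V) :
    tensorAct U V (a ⊗ₜ b) (u ⊗ₜ v) = (-1 : k) ^ (j * i) • ((a • u) ⊗ₜ[k] (b • v)) := by
  simp only [tensorAct, TensorProduct.lift.tmul, LinearMap.flip_apply]
  rw [grLift_apply _ _ hb]
  simp [sgnMap_apply _ _ hu, TensorProduct.smul_tmul']

theorem tensorAct_mul (x y : GradedTensorProduct k A.gr A.gr) :
    tensorAct U V ((GradedTensorProduct.of k A.gr A.gr).symm (x * y)) =
      tensorAct U V ((GradedTensorProduct.of k A.gr A.gr).symm x) *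
      tensorAct U V ((GradedTensorProduct.of k A.gr A.gr).symm y) := by
  let T : A.carrier ⊗[k] A.carrier →ₗ[k] A.carrier ⊗[k] A.carrier →ₗ[k]
      Module.End k (U.carrier ⊗[k] V.carrier) :=
    ((GradedTensorProduct.mulHom A.gr A.gr).compl₁₂
      (GradedTensorProduct.of k A.gr A.gr).toLinearMap
      (GradedTensorProduct.of k A.gr A.gr).toLinearMap).compr₂
      (tensorAct U V ∘ₗ (GradedTensorProduct.of k A.gr A.gr).symm.toLinearMap)
  let T' : A.carrier ⊗[k] A.carrier →ₗ[k] A.carrier ⊗[k] A.carrier →ₗ[k]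
      Module.End k (U.carrier ⊗[k] V.carrier) :=
    (LinearMap.mul k (Module.End k (U.carrier ⊗[k] V.carrier))).compl₁₂
      (tensorAct U V) (tensorAct U V)
  have key : T = T' := by
    refine tensor_ext A.isInternal A.isInternal fun i j a ha b hb => ?_
    refine tensor_ext A.isInternal A.isInternal fun i' j' a' ha' b' hb' => ?_
    refine tensor_ext U.isInternal V.isInternal fun p q u hu v hv => ?_
    have e := GradedTensorProduct.tmul_coe_mul_coe_tmul (R := k) A.gr A.gr a ⟨b, hb⟩ ⟨a', ha'⟩ b'
    have e' : T (a ⊗ₜ b) (a' ⊗ₜ b') =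
        tensorAct U V ((-1 : k) ^ (j * i') • ((a * a') ⊗ₜ (b * b'))) := by
      simp only [T, LinearMap.compr₂_apply, LinearMap.compl₁₂_apply, LinearEquiv.coe_coe,
        LinearMap.comp_apply]
      congr 1
      refine (congrArg _ e).trans ?_
      rw [Units.smul_def, ← Int.cast_smul_eq_zsmul k, map_smul]
      congr 1
      rw [← Int.cast_negOnePow, Int.negOnePow_def]
    rw [e', map_smul, LinearMap.smul_apply, tensorAct_apply U V _ (A.mul_mem hb hb') hu]
    simp only [T', LinearMap.compl₁₂_apply, LinearMap.mul_apply', Module.End.mul_apply]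
    rw [tensorAct_apply U V a' hb' hu, map_smul, tensorAct_apply U V a hb (U.smul_mem ha' hu)]
    simp only [smul_smul, ← neg_one_zpow_add]
    congr 2
    ring
  have := LinearMap.congr_fun₂ key ((GradedTensorProduct.of k A.gr A.gr).symm x)
    ((GradedTensorProduct.of k A.gr A.gr).symm y)
  exact this

theorem tensorAct_one : tensorAct U V ((1 : A.carrier) ⊗ₜ (1 : A.carrier)) = 1 := by
  refine tensor_ext U.isInternal V.isInternal fun p q u hu v hv => ?_
  rw [tensorAct_apply U V _ A.one_mem hu]
  simp

theorem tensorAct_mem {t : A.carrier ⊗[k] A.carrier} {n m : ℤ} (ht : t ∈ tensorGr A.gr A.gr n)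
    {x : U.carrier ⊗[k] V.carrier} (hx : x ∈ tensorGr U.gr V.gr m) :
    tensorAct U V t x ∈ tensorGr U.gr V.gr (n + m) := by
  induction ht using Submodule.span_induction with
  | zero => rw [map_zero]; exact zero_mem _
  | add s t _ _ h1 h2 => rw [map_add]; exact add_mem h1 h2
  | smul c t _ h => rw [map_smul]; exact Submodule.smul_mem _ _ h
  | mem t ht =>
    obtain ⟨i, j, a, b, rfl, ha, hb, rfl⟩ := ht
    induction hx using Submodule.span_induction with
    | zero => rw [map_zero]; exact zero_mem _
    | add s t _ _ h1 h2 => rw [map_add]; exact add_mem h1 h2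
    | smul c t _ h => rw [map_smul]; exact Submodule.smul_mem _ _ h
    | mem x hx =>
      obtain ⟨p, q, u, v, rfl, hu, hv, rfl⟩ := hx
      rw [tensorAct_apply U V a hb hu]
      exact Submodule.smul_mem _ _
        (tmul_mem_tensorGr (by ring) (U.smul_mem ha hu) (V.smul_mem hb hv))

theorem tensorD_tensorAct {t : A.carrier ⊗[k] A.carrier} {n : ℤ} (ht : t ∈ tensorGr A.gr A.gr n)
    (x : U.carrier ⊗[k] V.carrier) :
    tensorD U.isInternal U.d V.d (tensorAct U V t x) =
      tensorAct U V (tensorD A.isInternal A.d A.d t) x +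
        (-1 : k) ^ n • tensorAct U V t (tensorD U.isInternal U.d V.d x) := by
  induction ht using Submodule.span_induction with
  | zero => simp
  | add s t _ _ h1 h2 => simp only [map_add, LinearMap.add_apply, h1, h2, smul_add]; abel
  | smul c t _ h =>
    simp only [map_smul, LinearMap.smul_apply, h, smul_add]
    rw [smul_comm c]
  | mem t ht =>
    obtain ⟨i, j, a, b, rfl, ha, hb, rfl⟩ := ht
    have key : tensorD U.isInternal U.d V.d ∘ₗ (tensorAct U V (a ⊗ₜ b)) =
        tensorAct U V (tensorD A.isInternal A.d A.d (a ⊗ₜ b)) +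
        (-1 : k) ^ (i + j) • (tensorAct U V (a ⊗ₜ b) ∘ₗ tensorD U.isInternal U.d V.d) := by
      refine tensor_ext U.isInternal V.isInternal fun p q u hu v hv => ?_
      simp only [LinearMap.comp_apply, LinearMap.add_apply, LinearMap.smul_apply]
      rw [tensorAct_apply U V a hb hu, LinearMap.map_smul, tensorD_tmul _ _ _ (U.smul_mem ha hu),
        tensorD_tmul _ _ _ ha, tensorD_tmul _ _ _ hu, map_add, map_add,
        LinearMap.map_smul (tensorAct U V), LinearMap.map_smul (tensorAct U V (a ⊗ₜ[k] b)),
        LinearMap.add_apply, LinearMap.smul_apply, tensorAct_apply U V _ hb hu,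
        tensorAct_apply U V _ (A.d_mem hb) hu, tensorAct_apply U V _ hb (U.d_mem hu),
        tensorAct_apply U V _ hb hu, U.d_smul ha, V.d_smul hb]
      simp only [TensorProduct.add_tmul, TensorProduct.tmul_add, TensorProduct.tmul_smul,
        ← TensorProduct.smul_tmul', smul_add, smul_smul, ← neg_one_zpow_add]
      rw [show (-1 : k) ^ (i + j + j * (p - 1)) = (-1 : k) ^ (j * p + i) by congr 1; ring,
        show (-1 : k) ^ (j * p + (i + p)) = (-1 : k) ^ (i + (j - 1) * p) by
          rw [show j * p + (i + p) = (i + (j - 1) * p) + (p + p) by ring, neg_one_zpow_add,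
            neg_one_zpow_add k p p, neg_one_zpow_mul_self, mul_one],
        show (-1 : k) ^ (j * p + (i + p + j)) = (-1 : k) ^ (i + j + (p + j * p)) by congr 1; ring]
      abel
    exact LinearMap.congr_fun key x

end Action

variable (A : DGHopf.{u, v} k)

theorem tensorD_mem {M : Type w} [AddCommGroup M] [Module k M] {N : Type w'} [AddCommGroup N]
    [Module k N] {gr : ℤ → Submodule k M} {gr' : ℤ → Submodule k N} (h : DirectSum.IsInternal gr)
    {d : M →ₗ[k] M} {d' : N →ₗ[k] N} (hd : ∀ {i x}, x ∈ gr i → d x ∈ gr (i - 1))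
    (hd' : ∀ {i x}, x ∈ gr' i → d' x ∈ gr' (i - 1)) {n : ℤ} {t : M ⊗[k] N}
    (ht : t ∈ tensorGr gr gr' n) : tensorD h d d' t ∈ tensorGr gr gr' (n - 1) := by
  induction ht using Submodule.span_induction with
  | zero => rw [map_zero]; exact zero_mem _
  | add s t _ _ h1 h2 => rw [map_add]; exact add_mem h1 h2
  | smul c t _ h => rw [map_smul]; exact Submodule.smul_mem _ _ h
  | mem t ht =>
    obtain ⟨i, j, x, y, rfl, hx, hy, rfl⟩ := ht
    rw [tensorD_tmul _ _ _ hx]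
    exact add_mem (tmul_mem_tensorGr (by ring) (hd hx) hy)
      (Submodule.smul_mem _ _ (tmul_mem_tensorGr (by ring) hx (hd' hy)))

theorem tensorD_tensorD {M : Type w} [AddCommGroup M] [Module k M] {N : Type w'} [AddCommGroup N]
    [Module k N] {gr : ℤ → Submodule k M} {gr' : ℤ → Submodule k N} (h : DirectSum.IsInternal gr)
    (h' : DirectSum.IsInternal gr')
    {d : M →ₗ[k] M} {d' : N →ₗ[k] N} (hd : ∀ {i x}, x ∈ gr i → d x ∈ gr (i - 1))
    (hdd : ∀ x, d (d x) = 0) (hdd' : ∀ x, d' (d' x) = 0) (t : M ⊗[k] N) :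
    tensorD h d d' (tensorD h d d' t) = 0 := by
  have : tensorD h d d' ∘ₗ tensorD h d d' = 0 := by
    refine tensor_ext h h' fun i j x hx y hy => ?_
    rw [LinearMap.comp_apply, tensorD_tmul _ _ _ hx, map_add, map_smul, tensorD_tmul _ _ _ hx,
      tensorD_tmul _ _ _ (hd hx), hdd, hdd', neg_one_zpow_sub_one]
    simp
  exact LinearMap.congr_fun this t

/-- The diagonal action of `A` on `U ⊗ V`, through `Δ`. -/
def DGHopf.diagAct (U : DGModule.{u, v, w} A.toDGAlgebra) (V : DGModule.{u, v, w'} A.toDGAlgebra) :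
    A.carrier →+* Module.End k (U.carrier ⊗[k] V.carrier) where
  toFun a := tensorAct U V (A.Δ a)
  map_one' := by
    have : A.Δ 1 = (1 : A.carrier) ⊗ₜ (1 : A.carrier) := by
      change (GradedTensorProduct.of k A.gr A.gr).symm (A.comul 1) = _
      rw [map_one]; rfl
    rw [this, tensorAct_one]
  map_mul' a b := by
    change tensorAct U V ((GradedTensorProduct.of k A.gr A.gr).symm (A.comul (a * b))) = _
    rw [map_mul]
    exact tensorAct_mul U V _ _
  map_zero' := by simp
  map_add' a b := by simp

/-- The `A`-module structure of `U ⊗ₖ V`, through `Δ : A → A ⊗ A`. -/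
@[reducible]
def DGHopf.tensorModule (U : DGModule.{u, v, w} A.toDGAlgebra)
    (V : DGModule.{u, v, w'} A.toDGAlgebra) : Module A.carrier (U.carrier ⊗[k] V.carrier) :=
  Module.compHom _ (A.diagAct U V)

theorem DGHopf.tensor_isScalarTower (U : DGModule.{u, v, w} A.toDGAlgebra)
    (V : DGModule.{u, v, w'} A.toDGAlgebra) :
    @IsScalarTower k A.carrier (U.carrier ⊗[k] V.carrier) _ (A.tensorModule U V).toSMul _ :=
  @IsScalarTower.mk k A.carrier (U.carrier ⊗[k] V.carrier) _ (A.tensorModule U V).toSMul _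
    (fun c a x => by
      change tensorAct U V (A.Δ (c • a)) x = c • (tensorAct U V (A.Δ a) x)
      simp)

/-- The DG `A`-module `U ⊗ₖ V`, with `A` acting through `Δ : A → A ⊗ A`. -/
def DGHopf.tensor (U : DGModule.{u, v, w} A.toDGAlgebra) (V : DGModule.{u, v, w'} A.toDGAlgebra) :
    DGModule.{u, v, max w w'} A.toDGAlgebra :=
  { carrier := U.carrier ⊗[k] V.carrier
    module := A.tensorModule U V
    isScalarTower := A.tensor_isScalarTower U V
    gr := tensorGr U.gr V.gr
    isInternal := tensorGr_isInternal U.isInternal V.isInternal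
    smul_mem := fun ha hx => tensorAct_mem U V (A.comul_mem ha) hx
    d := tensorD U.isInternal U.d V.d
    d_mem := fun hx => tensorD_mem U.isInternal U.d_mem V.d_mem hx
    d_d := tensorD_tensorD U.isInternal V.isInternal U.d_mem U.d_d V.d_d
    d_smul := fun {i a} ha x => by
      have e : A.Δ (A.d a) = tensorD A.toDGAlgebra.isInternal A.d A.d (A.Δ a) := A.comul_d a
      change tensorD U.isInternal U.d V.d (tensorAct U V (A.Δ a) x) =
        tensorAct U V (A.Δ (A.d a)) x + (-1 : k) ^ i •
          tensorAct U V (A.Δ a) (tensorD U.isInternal U.d V.d x)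
      rw [e]
      exact tensorD_tensorAct U V (A.comul_mem ha) x }

end Tensor

/-! ### Hom complexes and their homology -/

section HomComplex

variable {k : Type u} [Field k] {A : DGAlgebra.{u, v} k}

section

variable (U : DGModule.{u, v, w} A) (V : DGModule.{u, v, w'} A)

/-- `Hom_A(U, V)_n`: the `k`-linear maps `f` with `f(U_i) ⊆ V_{i+n}` and
`f(ax) = (-1)^(n|a|) a f(x)`. -/
def homSub (n : ℤ) : Submodule k (U.carrier →ₗ[k] V.carrier) where
  carrier := {f | (∀ i, ∀ x ∈ U.gr i, f x ∈ V.gr (i + n)) ∧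
    ∀ i, ∀ a ∈ A.gr i, ∀ x, f (a • x) = (-1 : k) ^ (n * i) • (a • f x)}
  add_mem' := by
    rintro f g ⟨hf, hf'⟩ ⟨hg, hg'⟩
    refine ⟨fun i x hx => add_mem (hf i x hx) (hg i x hx), fun i a ha x => ?_⟩
    simp [hf' i a ha, hg' i a ha]
  zero_mem' := ⟨fun i x hx => zero_mem _, fun i a ha x => by simp⟩
  smul_mem' := by
    rintro c f ⟨hf, hf'⟩
    refine ⟨fun i x hx => Submodule.smul_mem _ _ (hf i x hx), fun i a ha x => ?_⟩
    simp only [LinearMap.smul_apply, hf' i a ha, smul_comm c]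

/-- The differential `∂f = d f - (-1)^n f d` of the complex `Hom_A(U, V)`, in degree `n`. -/
def homDiff (n : ℤ) : (U.carrier →ₗ[k] V.carrier) →ₗ[k] (U.carrier →ₗ[k] V.carrier) where
  toFun f := V.d ∘ₗ f - (-1 : k) ^ n • (f ∘ₗ U.d)
  map_add' f g := by ext x; simp; abel
  map_smul' c f := by ext x; simp [smul_sub, smul_comm c]

theorem homDiff_apply (n : ℤ) (f : U.carrier →ₗ[k] V.carrier) (x : U) :
    homDiff U V n f x = V.d (f x) - (-1 : k) ^ n • f (U.d x) := rfl

/-- The cycles of degree `n` in `Hom_A(U, V)`, that is, the chain maps of degree `n`. -/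
def homCycles (n : ℤ) : Submodule k (U.carrier →ₗ[k] V.carrier) :=
  homSub U V n ⊓ LinearMap.ker (homDiff U V n)

/-- The boundaries of degree `n` in `Hom_A(U, V)`, that is, the null-homotopic chain maps. -/
def homBoundaries (n : ℤ) : Submodule k (U.carrier →ₗ[k] V.carrier) :=
  (homSub U V (n + 1)).map (homDiff U V (n + 1))

/-- `H_n(Hom_A(U, V))`, the homotopy classes of chain maps `U → V` of degree `n`. -/
def HomH (n : ℤ) : Type (max w w') :=
  ↥(homCycles U V n) ⧸ (homBoundaries U V n).submoduleOf (homCycles U V n)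

instance (n : ℤ) : AddCommGroup (HomH U V n) :=
  inferInstanceAs (AddCommGroup (_ ⧸ (homBoundaries U V n).submoduleOf (homCycles U V n)))

instance (n : ℤ) : Module k (HomH U V n) :=
  inferInstanceAs (Module k (_ ⧸ (homBoundaries U V n).submoduleOf (homCycles U V n)))

/-- The homology class of a cycle. -/
def HomH.mk (n : ℤ) : ↥(homCycles U V n) →ₗ[k] HomH U V n :=
  ((homBoundaries U V n).submoduleOf (homCycles U V n)).mkQ

end

variable {U : DGModule.{u, v, w} A} {V : DGModule.{u, v, w'} A} {W : DGModule.{u, v, w''} A}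

theorem HomH.mk_surjective {n : ℤ} (x : HomH U V n) : ∃ f, HomH.mk U V n f = x :=
  Submodule.mkQ_surjective _ x

theorem HomH.mk_eq_iff {n : ℤ} {f g : ↥(homCycles U V n)} :
    HomH.mk U V n f = HomH.mk U V n g ↔
      (f : U.carrier →ₗ[k] V.carrier) - g ∈ homBoundaries U V n :=
  Submodule.Quotient.eq _

theorem HomH.mk_eq_zero_iff {n : ℤ} {f : ↥(homCycles U V n)} :
    HomH.mk U V n f = 0 ↔ (f : U.carrier →ₗ[k] V.carrier) ∈ homBoundaries U V n :=
  Submodule.Quotient.mk_eq_zero _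

theorem homCycles_comm {n : ℤ} {f : U.carrier →ₗ[k] V.carrier} (hf : f ∈ homCycles U V n) (x : U) :
    V.d (f x) = (-1 : k) ^ n • f (U.d x) :=
  sub_eq_zero.1 (LinearMap.congr_fun (LinearMap.mem_ker.1 hf.2) x)

theorem mem_homCycles {n : ℤ} {f : U.carrier →ₗ[k] V.carrier} (hf : f ∈ homSub U V n)
    (h : ∀ x, V.d (f x) = (-1 : k) ^ n • f (U.d x)) : f ∈ homCycles U V n :=
  ⟨hf, LinearMap.mem_ker.2 (LinearMap.ext fun x => sub_eq_zero.2 (h x))⟩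

theorem homDiff_mem {n : ℤ} {f : U.carrier →ₗ[k] V.carrier} (hf : f ∈ homSub U V n) :
    homDiff U V n f ∈ homSub U V (n - 1) := by
  refine ⟨fun i x hx => ?_, fun i a ha x => ?_⟩
  · rw [homDiff_apply]
    refine sub_mem ?_ (Submodule.smul_mem _ _ ?_)
    · have := V.d_mem (hf.1 i x hx)
      rwa [show i + n - 1 = i + (n - 1) by ring] at this
    · have := hf.1 _ _ (U.d_mem hx)
      rwa [show i - 1 + n = i + (n - 1) by ring] at this
  · have e1 : (-1 : k) ^ (n * (i - 1)) = (-1) ^ (n * i) * (-1) ^ n := by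
      rw [← neg_one_zpow_add, show n * i + n = n * (i - 1) + (n + n) by ring, neg_one_zpow_add k _
        (n + n), neg_one_zpow_add k n n, neg_one_zpow_mul_self, mul_one]
    have e2 : (-1 : k) ^ ((n - 1) * i) = (-1) ^ (n * i) * (-1) ^ i := by
      rw [← neg_one_zpow_add, show n * i + i = (n - 1) * i + (i + i) by ring, neg_one_zpow_add k _
        (i + i), neg_one_zpow_add k i i, neg_one_zpow_mul_self, mul_one]
    have hn := neg_one_zpow_mul_self k n
    simp only [homDiff_apply]
    rw [hf.2 i a ha, LinearMap.map_smul, V.d_smul ha, U.d_smul ha, map_add,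
      hf.2 _ _ (A.d_mem ha), LinearMap.map_smul, hf.2 i a ha, e1, e2]
    simp only [smul_add, smul_sub, smul_smul, smul_comm a]
    rw [show (-1 : k) ^ n * ((-1) ^ (n * i) * (-1) ^ n) =
      (-1) ^ (n * i) * ((-1) ^ n * (-1) ^ n) by ring, hn, mul_one,
      show (-1 : k) ^ n * ((-1) ^ i * (-1) ^ (n * i)) = (-1) ^ (n * i) * (-1) ^ i * (-1) ^ n by ring]
    abel

theorem homDiff_homDiff (n m : ℤ) (h : m + 1 = n) (f : U.carrier →ₗ[k] V.carrier) :
    homDiff U V m (homDiff U V n f) = 0 := by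
  subst h
  ext x
  simp [homDiff_apply, V.d_d, U.d_d, neg_one_zpow_add_one]

theorem homBoundaries_le (n : ℤ) : homBoundaries U V n ≤ homCycles U V n := by
  rintro _ ⟨h, hh, rfl⟩
  refine ⟨?_, homDiff_homDiff _ _ rfl h⟩
  have := homDiff_mem hh
  rwa [add_sub_cancel_right] at this

theorem homSub_comp {m n p : ℤ} (h : m + n = p) {g : V.carrier →ₗ[k] W.carrier}
    {f : U.carrier →ₗ[k] V.carrier} (hg : g ∈ homSub V W m) (hf : f ∈ homSub U V n) :
    g ∘ₗ f ∈ homSub U W p := by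
  subst h
  refine ⟨fun i x hx => ?_, fun i a ha x => ?_⟩
  · have := hg.1 _ _ (hf.1 i x hx)
    rwa [show i + n + m = i + (m + n) by ring] at this
  · rw [LinearMap.comp_apply, hf.2 i a ha, LinearMap.map_smul, hg.2 i a ha, smul_smul,
      ← neg_one_zpow_add, LinearMap.comp_apply]
    congr 2; ring

theorem homDiff_comp {m n p : ℤ} (h : m + n = p) (g : V.carrier →ₗ[k] W.carrier)
    (f : U.carrier →ₗ[k] V.carrier) :
    homDiff U W p (g ∘ₗ f) =
      homDiff V W m g ∘ₗ f + (-1 : k) ^ m • (g ∘ₗ homDiff U V n f) := by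
  subst h
  ext x
  simp only [homDiff_apply, LinearMap.comp_apply, LinearMap.add_apply, LinearMap.smul_apply,
    map_sub, LinearMap.map_smul, smul_sub, smul_smul, neg_one_zpow_add]
  abel

theorem homCycles_comp {m n p : ℤ} (h : m + n = p) {g : V.carrier →ₗ[k] W.carrier}
    {f : U.carrier →ₗ[k] V.carrier} (hg : g ∈ homCycles V W m) (hf : f ∈ homCycles U V n) :
    g ∘ₗ f ∈ homCycles U W p := by
  refine ⟨homSub_comp h hg.1 hf.1, LinearMap.mem_ker.2 ?_⟩
  rw [homDiff_comp h, LinearMap.mem_ker.1 hg.2, LinearMap.mem_ker.1 hf.2]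
  simp

theorem homBoundaries_comp_left {m n p : ℤ} (h : m + n = p) {g : V.carrier →ₗ[k] W.carrier}
    {f : U.carrier →ₗ[k] V.carrier} (hg : g ∈ homBoundaries V W m) (hf : f ∈ homCycles U V n) :
    g ∘ₗ f ∈ homBoundaries U W p := by
  obtain ⟨s, hs, rfl⟩ := hg
  refine ⟨s ∘ₗ f, homSub_comp (by omega) hs hf.1, ?_⟩
  rw [homDiff_comp (m := m + 1) (n := n) (by omega), LinearMap.mem_ker.1 hf.2]
  simp

theorem homBoundaries_comp_right {m n p : ℤ} (h : m + n = p) {g : V.carrier →ₗ[k] W.carrier}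
    {f : U.carrier →ₗ[k] V.carrier} (hg : g ∈ homCycles V W m) (hf : f ∈ homBoundaries U V n) :
    g ∘ₗ f ∈ homBoundaries U W p := by
  obtain ⟨s, hs, rfl⟩ := hf
  refine ⟨(-1 : k) ^ m • (g ∘ₗ s), Submodule.smul_mem _ _ (homSub_comp (by omega) hg.1 hs), ?_⟩
  rw [LinearMap.map_smul, homDiff_comp (m := m) (n := n + 1) (by omega), LinearMap.mem_ker.1 hg.2,
    LinearMap.zero_comp, zero_add, smul_smul, neg_one_zpow_mul_self, one_smul]

/-- Composition of chain maps. -/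
def homCycles.comp (m n p : ℤ) (h : m + n = p) :
    ↥(homCycles V W m) →ₗ[k] ↥(homCycles U V n) →ₗ[k] ↥(homCycles U W p) :=
  LinearMap.mk₂ k (fun g f => ⟨g.1 ∘ₗ f.1, homCycles_comp h g.2 f.2⟩)
    (fun _ _ _ => rfl) (fun _ _ _ => rfl)
    (fun _ _ _ => Subtype.ext (LinearMap.comp_add _ _ _))
    (fun _ _ _ => Subtype.ext (LinearMap.comp_smul _ _ _))

/-- Composition of homotopy classes of chain maps. -/
def HomH.comp {m n p : ℤ} (h : m + n = p) : HomH V W m →ₗ[k] HomH U V n →ₗ[k] HomH U W p :=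
  LinearMap.flip (Submodule.liftQ _ (LinearMap.flip (Submodule.liftQ _
    ((homCycles.comp m n p h).compr₂ (HomH.mk U W p))
    (by
      intro g hg
      refine LinearMap.mem_ker.2 (LinearMap.ext fun f => ?_)
      exact HomH.mk_eq_zero_iff.2 (homBoundaries_comp_left h hg f.2))))
    (by
      intro f hf
      refine LinearMap.mem_ker.2 (LinearMap.ext fun g => ?_)
      obtain ⟨g, rfl⟩ := HomH.mk_surjective g
      exact HomH.mk_eq_zero_iff.2 (homBoundaries_comp_right h g.2 hf)))

theorem HomH.comp_mk {m n p : ℤ} (h : m + n = p) (g : ↥(homCycles V W m))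
    (f : ↥(homCycles U V n)) :
    HomH.comp h (HomH.mk V W m g) (HomH.mk U V n f) =
      HomH.mk U W p ⟨g.1 ∘ₗ f.1, homCycles_comp h g.2 f.2⟩ := rfl

theorem id_mem_homCycles (U : DGModule.{u, v, w} A) : LinearMap.id ∈ homCycles U U 0 :=
  mem_homCycles ⟨fun i x hx => by simpa using hx, fun i a ha x => by simp⟩ (fun x => by simp)

/-- The class of the identity map. -/
def HomH.id (U : DGModule.{u, v, w} A) : HomH U U 0 :=
  HomH.mk U U 0 ⟨LinearMap.id, id_mem_homCycles U⟩

/-- A morphism of DG modules (a chain map of degree `0`) which induces isomorphisms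
`H_n(U) → H_n(V)` for all `n`. -/
structure IsQuasiIso (f : U.carrier →ₗ[k] V.carrier) : Prop where
  mem : f ∈ homCycles U V 0
  injective : ∀ n, ∀ z ∈ U.gr n, U.d z = 0 → (∃ y ∈ V.gr (n + 1), V.d y = f z) →
    ∃ x ∈ U.gr (n + 1), U.d x = z
  surjective : ∀ n, ∀ t ∈ V.gr n, V.d t = 0 →
    ∃ z ∈ U.gr n, U.d z = 0 ∧ ∃ y ∈ V.gr (n + 1), V.d y = t - f z

/-- A semifree filtration of `F`: an exhaustive filtration `0 = F⁰ ⊆ F¹ ⊆ ⋯` by DG submodules such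
that each `Fⁿ⁺¹/Fⁿ` is a direct sum of suspensions of `A`, that is, has an `A`-basis of homogeneous
cycles; the elements `e i` of `Fⁿ⁺¹` represent such a basis. (By induction, each `Fⁿ` then is
graded and stable under `d`.) -/
def DGModule.IsSemifree (F : DGModule.{u, v, w} A) : Prop :=
  ∃ fil : ℕ → Submodule A F.carrier, fil 0 = ⊥ ∧ (⨆ n, fil n) = ⊤ ∧
    ∀ n, ∃ (ι : Type w) (e : ι → F.carrier) (deg : ι → ℤ),
      (∀ i, e i ∈ F.gr (deg i)) ∧ (∀ i, F.d (e i) ∈ fil n) ∧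
      LinearIndependent A (fun i => (fil n).mkQ (e i)) ∧
      fil (n + 1) = fil n ⊔ Submodule.span A (Set.range e)

/-- A semifree resolution `F → U` of the DG module `U`. -/
structure SemifreeResolution (U : DGModule.{u, v, w} A) where
  F : DGModule.{u, v, w'} A
  semifree : F.IsSemifree
  π : F.carrier →ₗ[k] U.carrier
  quasiIso : IsQuasiIso π

end HomComplex

/-! ### The lifting property of semifree modules -/

section Lifting

variable {k : Type u} [Field k] {A : DGAlgebra.{u, v} k}

theorem DGModule.IsSemifree.exists_basis {F : DGModule.{u, v, w} A} (hF : F.IsSemifree) :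
    ∃ (ι : Type w) (b : Module.Basis ι A F.carrier) (deg : ι → ℤ) (rk : ι → ℕ),
      (∀ i, b i ∈ F.gr (deg i)) ∧
      ∀ i, F.d (b i) ∈ Submodule.span A (b '' {j | rk j < rk i}) := by
  obtain ⟨fil, h0, htop, H⟩ := hF
  choose ι e deg hdeg hd hli hspan using H
  let ev : (Σ n, ι n) → F.carrier := fun p => e p.1 p.2
  let s : ℕ → Set (Σ n, ι n) := fun n => {p | p.1 < n}
  have hs : ∀ n, s (n + 1) = s n ∪ Set.range (fun i : ι n => (⟨n, i⟩ : Σ n, ι n)) := by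
    intro n
    ext ⟨m, i⟩
    simp only [s, Set.mem_ofPred_eq, Set.mem_union, Set.mem_range]
    constructor
    · intro h
      rcases Nat.lt_succ_iff_lt_or_eq.1 h with h | rfl
      · exact Or.inl h
      · exact Or.inr ⟨i, rfl⟩
    · rintro (h | ⟨j, hj⟩)
      · omega
      · have := congrArg Sigma.fst hj
        simp only at this
        omega
  have hfil : ∀ n, Submodule.span A (ev '' s n) = fil n := by
    intro n
    induction n with
    | zero => simp [s, h0]
    | succ n ih =>
      rw [hs, Set.image_union, Submodule.span_union, ih, hspan n, ← Set.range_comp]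
      rfl
  have hind : ∀ n, LinearIndepOn A ev (s n) := by
    intro n
    induction n with
    | zero =>
      have : s 0 = ∅ := by ext; simp [s]
      rw [this]; exact linearIndepOn_empty A ev
    | succ n ih =>
      rw [hs]
      refine ih.union_of_quotient ?_
      rw [hfil, LinearIndepOn.eq_1]
      have hinj : Function.Injective (fun i : ι n => (⟨n, i⟩ : Σ n, ι n)) := sigma_mk_injective
      rw [← linearIndependent_equiv (Equiv.ofInjective _ hinj)]
      exact hli n
  have hU : (⋃ n, s n) = Set.univ := by
    ext p; simp only [Set.mem_iUnion, Set.mem_univ, iff_true]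
    exact ⟨p.1 + 1, Nat.lt_succ_self _⟩
  have hmono : Monotone s := fun m n h p hp => lt_of_lt_of_le (show p.1 < m from hp) h
  have hall : LinearIndependent A ev := by
    rw [← linearIndepOn_univ_iff, ← hU]
    exact linearIndepOn_iUnion_of_directed hmono.directed_le hind
  have hsp : ⊤ ≤ Submodule.span A (Set.range ev) := by
    rw [← htop]
    refine iSup_le fun n => ?_
    rw [← hfil n]
    exact Submodule.span_mono (Set.image_subset_range _ _)
  let b₀ := Module.Basis.mk hall hsp
  have hb₀ : ∀ p, b₀ p = ev p := fun p => Module.Basis.mk_apply hall hsp p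
  have hb₀' : (b₀ : (Σ n, ι n) → F.carrier) = ev := funext hb₀
  refine ⟨Σ n, ι n, b₀, fun p => deg p.1 p.2, fun p => p.1, fun p => ?_, fun p => ?_⟩
  · rw [hb₀]; exact hdeg p.1 p.2
  · rw [hb₀', show {j : Σ n, ι n | j.1 < p.1} = s p.1 from rfl, hfil]
    exact hd p.1 p.2

theorem homSub_smul {U : DGModule.{u, v, w} A} {V : DGModule.{u, v, w'} A} {n : ℤ}
    {f : U.carrier →ₗ[k] V.carrier} (hf : f ∈ homSub U V n) (a : A) (x : U) :
    f (a • x) = sgnMap A.isInternal n a • f x := by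
  have : f ∘ₗ (LinearMap.toSpanSingleton A U.carrier x).restrictScalars k =
      (LinearMap.toSpanSingleton A V.carrier (f x)).restrictScalars k ∘ₗ
        sgnMap A.isInternal n := by
    refine gr_ext A.isInternal fun i a ha => ?_
    simp only [LinearMap.comp_apply, LinearMap.coe_restrictScalars,
      LinearMap.toSpanSingleton_apply]
    rw [hf.2 i a ha, sgnMap_apply _ _ ha, smul_assoc]
  exact LinearMap.congr_fun this a

theorem sgnMap_mul {n i : ℤ} {a : A} (ha : a ∈ A.gr i) (b : A) :
    sgnMap A.isInternal n (a * b) = (-1 : k) ^ (n * i) • (a * sgnMap A.isInternal n b) := by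
  have : sgnMap A.isInternal n ∘ₗ LinearMap.mulLeft k a =
      (-1 : k) ^ (n * i) • (LinearMap.mulLeft k a ∘ₗ sgnMap A.isInternal n) := by
    refine gr_ext A.isInternal fun j b hb => ?_
    simp only [LinearMap.comp_apply, LinearMap.mulLeft_apply, LinearMap.smul_apply]
    rw [sgnMap_apply _ _ (A.mul_mem ha hb), sgnMap_apply _ _ hb, mul_smul_comm, smul_smul,
      ← neg_one_zpow_add]
    congr 2; ring
  exact LinearMap.congr_fun this b

theorem basis_lin_ext {F : DGModule.{u, v, w} A} {ι : Type w} (b : Module.Basis ι A F.carrier)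
    {N : Type w'} [AddCommGroup N] [Module k N] {f g : F.carrier →ₗ[k] N}
    (H : ∀ i j, ∀ a ∈ A.gr j, f (a • b i) = g (a • b i)) : f = g := by
  have h1 : ∀ i (a : A), f (a • b i) = g (a • b i) := by
    intro i a
    have : f ∘ₗ (LinearMap.toSpanSingleton A F.carrier (b i)).restrictScalars k =
        g ∘ₗ (LinearMap.toSpanSingleton A F.carrier (b i)).restrictScalars k :=
      gr_ext A.isInternal fun j a ha => H i j a ha
    exact LinearMap.congr_fun this a
  ext x
  have hx : x ∈ Submodule.span A (Set.range b) := by rw [b.span_eq]; trivial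
  obtain ⟨c, rfl⟩ := Finsupp.mem_span_range_iff_exists_finsupp.1 hx
  simp [Finsupp.sum, map_sum, h1]

/-- A graded linear map is freely determined by its values on a homogeneous basis. -/
theorem exists_homSub_of_basis {F : DGModule.{u, v, w} A} {V : DGModule.{u, v, w'} A} {ι : Type w}
    (b : Module.Basis ι A F.carrier) (deg : ι → ℤ) (hb : ∀ i, b i ∈ F.gr (deg i)) (n : ℤ)
    (g : ι → V.carrier) (hg : ∀ i, g i ∈ V.gr (deg i + n)) :
    ∃ f ∈ homSub F V n, ∀ i, f (b i) = g i := by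
  let f : F.carrier →ₗ[k] V.carrier :=
    (Finsupp.lsum k (fun i => (LinearMap.toSpanSingleton A V.carrier (g i)).restrictScalars k ∘ₗ
      sgnMap A.isInternal n)) ∘ₗ (b.repr.toLinearMap.restrictScalars k)
  have hf : ∀ i (a : A), f (a • b i) = sgnMap A.isInternal n a • g i := by
    intro i a
    simp [f]
  have hone : sgnMap A.isInternal n (1 : A) = 1 := by
    rw [sgnMap_apply _ _ A.one_mem]; simp
  refine ⟨f, ⟨?_, ?_⟩, fun i => ?_⟩
  · intro m x hx
    have key : f ∘ₗ grProj F.isInternal m = grProj V.isInternal (m + n) ∘ₗ f := by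
      refine basis_lin_ext b fun i j a ha => ?_
      have h1 := F.smul_mem ha (hb i)
      have h2 : f (a • b i) ∈ V.gr (j + (deg i + n)) := by
        rw [hf, sgnMap_apply _ _ ha, smul_assoc]
        exact Submodule.smul_mem _ _ (V.smul_mem ha (hg i))
      simp only [LinearMap.comp_apply]
      by_cases hm : j + deg i = m
      · subst hm
        rw [grProj_same _ h1, grProj_same _ (by rwa [add_assoc])]
      · rw [grProj_ne _ h1 hm, map_zero, grProj_ne _ h2 (by omega)]
    have := LinearMap.congr_fun key x
    simp only [LinearMap.comp_apply, grProj_same _ hx] at this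
    rw [this]; exact grProj_mem _ _ _
  · intro i a ha x
    have key : f ∘ₗ (Algebra.lsmul k k F.carrier a) =
        (-1 : k) ^ (n * i) • ((Algebra.lsmul k k V.carrier a) ∘ₗ f) := by
      refine basis_lin_ext b fun l j c hc => ?_
      simp only [LinearMap.comp_apply, LinearMap.smul_apply, Algebra.lsmul_coe]
      rw [hf, smul_smul, hf, sgnMap_mul ha, smul_assoc, mul_smul]
    exact LinearMap.congr_fun key x
  · have := hf i 1
    rwa [one_smul, hone, one_smul] at this

theorem homSub_eq_on_span {F : DGModule.{u, v, w} A} {V : DGModule.{u, v, w'} A} {n : ℤ}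
    {f g : F.carrier →ₗ[k] V.carrier} (hf : f ∈ homSub F V n) (hg : g ∈ homSub F V n)
    {s : Set F.carrier} (H : ∀ x ∈ s, f x = g x) {x : F} (hx : x ∈ Submodule.span A s) :
    f x = g x := by
  induction hx using Submodule.span_induction with
  | mem x hx => exact H x hx
  | zero => simp
  | add x y _ _ hx hy => rw [map_add, map_add, hx, hy]
  | smul a x _ hx => rw [homSub_smul hf, homSub_smul hg, hx]

theorem IsQuasiIso.cone {G : DGModule.{u, v, w} A} {V : DGModule.{u, v, w'} A}
    {q : G.carrier →ₗ[k] V.carrier} (hq : IsQuasiIso q) {m : ℤ} {z : G} (hz : z ∈ G.gr m)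
    (hdz : G.d z = 0) {t : V} (ht : t ∈ V.gr (m + 1)) (hqz : q z = V.d t) :
    ∃ g ∈ G.gr (m + 1), ∃ y ∈ V.gr (m + 2), G.d g = z ∧ V.d y = q g - t := by
  have hqd : ∀ x, V.d (q x) = q (G.d x) := fun x => by
    simpa using homCycles_comm hq.mem x
  obtain ⟨g, hg, hdg⟩ := hq.injective m z hz hdz ⟨t, ht, hqz.symm⟩
  have hqg : q g ∈ V.gr (m + 1) := by simpa using hq.mem.1.1 _ _ hg
  obtain ⟨c, hc, hdc, y, hy, hdy⟩ := hq.surjective (m + 1) (q g - t) (sub_mem hqg ht)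
    (by rw [map_sub, hqd, hdg, hqz, sub_self])
  refine ⟨g - c, sub_mem hg hc, y, by rwa [add_assoc] at hy, by rw [map_sub, hdg, hdc, sub_zero], ?_⟩
  rw [hdy, map_sub]; abel

/-- Semifree modules lift along quasi-isomorphisms, up to homotopy. -/
theorem exists_lift {F : DGModule.{u, v, w} A} (hF : F.IsSemifree) {G : DGModule.{u, v, w'} A}
    {V : DGModule.{u, v, w''} A} {q : G.carrier →ₗ[k] V.carrier} (hq : IsQuasiIso q) {n : ℤ}
    {α : F.carrier →ₗ[k] V.carrier} (hα : α ∈ homSub F V n) {β : F.carrier →ₗ[k] G.carrier}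
    (hβ : β ∈ homCycles F G (n - 1)) (hαβ : homDiff F V n α = q ∘ₗ β) :
    ∃ γ ∈ homSub F G n, ∃ h ∈ homSub F V (n + 1),
      homDiff F G n γ = β ∧ homDiff F V (n + 1) h = q ∘ₗ γ - α := by
  obtain ⟨ι, b, deg, rk, hb, hdb⟩ := hF.exists_basis
  have hqd : ∀ x, V.d (q x) = q (G.d x) := fun x => by simpa using homCycles_comm hq.mem x
  have hβd : ∀ x, G.d (β x) = - ((-1 : k) ^ n • β (F.d x)) := fun x => by
    rw [homCycles_comm hβ x, neg_one_zpow_sub_one, neg_smul]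
  have hαd : ∀ x, V.d (α x) = q (β x) + (-1 : k) ^ n • α (F.d x) := fun x => by
    have := LinearMap.congr_fun hαβ x
    rw [homDiff_apply, sub_eq_iff_eq_add] at this
    exact this
  -- the equations to be solved, at a given element
  let Eq : (F.carrier →ₗ[k] G.carrier) → (F.carrier →ₗ[k] V.carrier) → F.carrier → Prop :=
    fun γ h x => G.d (γ x) = β x + (-1 : k) ^ n • γ (F.d x) ∧
      V.d (h x) = q (γ x) - (α x + (-1 : k) ^ n • h (F.d x))
  let St : ℕ → Type _ := fun r => {p : (F.carrier →ₗ[k] G.carrier) × (F.carrier →ₗ[k] V.carrier) //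
    p.1 ∈ homSub F G n ∧ p.2 ∈ homSub F V (n + 1) ∧ ∀ i, rk i < r → Eq p.1 p.2 (b i)}
  have step : ∀ r (p : St r), ∃ p' : St (r + 1), ∀ i, rk i < r →
      p'.1.1 (b i) = p.1.1 (b i) ∧ p'.1.2 (b i) = p.1.2 (b i) := by
    rintro r ⟨⟨γ, h⟩, hγ, hh, hE⟩
    simp only at hγ hh hE
    -- the equation holds on the whole span of the lower part
    have hE1 : ∀ x ∈ Submodule.span A (b '' {j | rk j < r}),
        G.d (γ x) = β x + (-1 : k) ^ n • γ (F.d x) := by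
      intro x hx
      have e := homSub_eq_on_span (homDiff_mem hγ) hβ.1 (s := b '' {j | rk j < r}) (by
        rintro _ ⟨i, hi, rfl⟩
        rw [homDiff_apply, (hE i hi).1, add_sub_cancel_right]) hx
      rw [homDiff_apply, sub_eq_iff_eq_add] at e
      exact e
    have hE2 : ∀ x ∈ Submodule.span A (b '' {j | rk j < r}),
        V.d (h x) = q (γ x) - (α x + (-1 : k) ^ n • h (F.d x)) := by
      intro x hx
      have hqγ : q ∘ₗ γ - α ∈ homSub F V (n + 1 - 1) := by
        rw [add_sub_cancel_right]
        exact sub_mem (homSub_comp (zero_add n) hq.mem.1 hγ) hα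
      have e := homSub_eq_on_span (homDiff_mem hh) hqγ (s := b '' {j | rk j < r}) (by
        rintro _ ⟨i, hi, rfl⟩
        rw [homDiff_apply, (hE i hi).2, neg_one_zpow_add_one, neg_smul]
        simp only [LinearMap.sub_apply, LinearMap.comp_apply]
        abel) hx
      rw [homDiff_apply, neg_one_zpow_add_one, neg_smul, sub_neg_eq_add] at e
      rw [eq_sub_iff_add_eq.2 e]
      simp only [LinearMap.sub_apply, LinearMap.comp_apply]
      abel
    have ex : ∀ i, ∃ g ∈ G.gr (deg i + n), ∃ y ∈ V.gr (deg i + (n + 1)),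
        (rk i < r → g = γ (b i) ∧ y = h (b i)) ∧
        (rk i = r → G.d g = β (b i) + (-1 : k) ^ n • γ (F.d (b i)) ∧
          V.d y = q g - (α (b i) + (-1 : k) ^ n • h (F.d (b i)))) := by
      intro i
      rcases eq_or_ne (rk i) r with hi | hi
      · have hx := hdb i
        rw [hi] at hx
        have hz : β (b i) + (-1 : k) ^ n • γ (F.d (b i)) ∈ G.gr (deg i + n - 1) := by
          refine add_mem ?_ (Submodule.smul_mem _ _ ?_)
          · have := hβ.1.1 _ _ (hb i)
            rwa [← add_sub_assoc] at this
          · have := hγ.1 _ _ (F.d_mem (hb i))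
            rwa [show deg i - 1 + n = deg i + n - 1 by ring] at this
        have ht : α (b i) + (-1 : k) ^ n • h (F.d (b i)) ∈ V.gr (deg i + n - 1 + 1) := by
          refine add_mem ?_ (Submodule.smul_mem _ _ ?_)
          · have := hα.1 _ _ (hb i)
            rwa [sub_add_cancel]
          · have := hh.1 _ _ (F.d_mem (hb i))
            rwa [show deg i - 1 + (n + 1) = deg i + n - 1 + 1 by ring] at this
        obtain ⟨g, hg, y, hy, h1, h2⟩ := hq.cone hz (by
          rw [map_add, LinearMap.map_smul, hβd, hE1 _ hx, F.d_d]; simp) ht (by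
          rw [map_add, map_add, LinearMap.map_smul, LinearMap.map_smul, hαd, hE2 _ hx, F.d_d, map_zero,
            smul_zero, add_zero, smul_sub]
          abel)
        refine ⟨g, by rwa [sub_add_cancel] at hg, y, ?_, fun hlt => absurd hi hlt.ne, fun _ => ⟨h1, h2⟩⟩
        rwa [show deg i + n - 1 + 2 = deg i + (n + 1) by ring] at hy
      · exact ⟨γ (b i), hγ.1 _ _ (hb i), h (b i), hh.1 _ _ (hb i), fun _ => ⟨rfl, rfl⟩,
          fun h => absurd h hi⟩
    choose g hg y hy hlt heq using ex
    obtain ⟨γ', hγ', hγb⟩ := exists_homSub_of_basis b deg hb n g hg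
    obtain ⟨h', hh', hhb⟩ := exists_homSub_of_basis b deg hb (n + 1) y hy
    have ag : ∀ i, rk i < r → γ' (b i) = γ (b i) ∧ h' (b i) = h (b i) := fun i hi =>
      ⟨by rw [hγb, (hlt i hi).1], by rw [hhb, (hlt i hi).2]⟩
    have agd : ∀ i, rk i ≤ r → γ' (F.d (b i)) = γ (F.d (b i)) ∧ h' (F.d (b i)) = h (F.d (b i)) := by
      intro i hi
      have hx : F.d (b i) ∈ Submodule.span A (b '' {j | rk j < r}) :=
        Submodule.span_mono (Set.image_mono fun j hj => lt_of_lt_of_le (show rk j < rk i from hj) hi)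
          (hdb i)
      exact ⟨homSub_eq_on_span hγ' hγ (by rintro _ ⟨j, hj, rfl⟩; exact (ag j hj).1) hx,
        homSub_eq_on_span hh' hh (by rintro _ ⟨j, hj, rfl⟩; exact (ag j hj).2) hx⟩
    refine ⟨⟨⟨γ', h'⟩, hγ', hh', fun i hi => ?_⟩, ag⟩
    have hi' : rk i ≤ r := Nat.lt_succ_iff.1 hi
    simp only [Eq]
    rw [(agd i hi').1, (agd i hi').2]
    rcases hi'.lt_or_eq with hlt' | heq'
    · rw [(ag i hlt').1, (ag i hlt').2]; exact hE i hlt'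
    · rw [hγb, hhb]; exact heq i heq'
  choose nxt hnxt using step
  let seq : ∀ r, St r := fun r => Nat.rec ⟨⟨0, 0⟩, zero_mem _, zero_mem _, fun i hi => absurd hi (Nat.not_lt_zero _)⟩
    (fun r p => nxt r p) r
  have hseq : ∀ r s i, rk i < r → r ≤ s → (seq s).1.1 (b i) = (seq r).1.1 (b i) ∧
      (seq s).1.2 (b i) = (seq r).1.2 (b i) := by
    intro r s i hi hrs
    induction s, hrs using Nat.le_induction with
    | base => exact ⟨rfl, rfl⟩
    | succ s hs ih =>
      have := hnxt s (seq s) i (lt_of_lt_of_le hi hs)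
      exact ⟨this.1.trans ih.1, this.2.trans ih.2⟩
  obtain ⟨γ, hγ, hγb⟩ := exists_homSub_of_basis b deg hb n
    (fun i => (seq (rk i + 1)).1.1 (b i)) (fun i => (seq (rk i + 1)).2.1.1 _ _ (hb i))
  obtain ⟨h, hh, hhb⟩ := exists_homSub_of_basis b deg hb (n + 1)
    (fun i => (seq (rk i + 1)).1.2 (b i)) (fun i => (seq (rk i + 1)).2.2.1.1 _ _ (hb i))
  have hE : ∀ i, Eq γ h (b i) := by
    intro i
    have e := (seq (rk i + 1)).2.2.2 i (Nat.lt_succ_self _)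
    have ag : ∀ j, rk j < rk i → γ (b j) = (seq (rk i + 1)).1.1 (b j) ∧
        h (b j) = (seq (rk i + 1)).1.2 (b j) := by
      intro j hj
      have := hseq (rk j + 1) (rk i + 1) j (Nat.lt_succ_self _) (by omega)
      exact ⟨by rw [hγb, this.1], by rw [hhb, this.2]⟩
    simp only [Eq] at e ⊢
    rw [hγb, hhb, homSub_eq_on_span hγ (seq (rk i + 1)).2.1
        (by rintro _ ⟨j, hj, rfl⟩; exact (ag j hj).1) (hdb i),
      homSub_eq_on_span hh (seq (rk i + 1)).2.2.1
        (by rintro _ ⟨j, hj, rfl⟩; exact (ag j hj).2) (hdb i)]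
    exact e
  have span_all : ∀ x : F.carrier, x ∈ Submodule.span A (Set.range b) := fun x => by
    rw [b.span_eq]; trivial
  refine ⟨γ, hγ, h, hh, ?_, ?_⟩
  · ext x
    refine homSub_eq_on_span (homDiff_mem hγ) hβ.1 ?_ (span_all x)
    rintro _ ⟨i, rfl⟩
    rw [homDiff_apply, (hE i).1, add_sub_cancel_right]
  · ext x
    have hqγ : q ∘ₗ γ - α ∈ homSub F V (n + 1 - 1) := by
      rw [add_sub_cancel_right]
      exact sub_mem (homSub_comp (zero_add n) hq.mem.1 hγ) hα
    refine homSub_eq_on_span (homDiff_mem hh) hqγ ?_ (span_all x)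
    rintro _ ⟨i, rfl⟩
    rw [homDiff_apply, (hE i).2, neg_one_zpow_add_one, neg_smul]
    simp only [LinearMap.sub_apply, LinearMap.comp_apply]
    abel

/-- For `F` semifree and `q : G → V` a quasi-isomorphism, `γ ↦ qγ` induces an isomorphism
`H_n(Hom_A(F, G)) ≅ H_n(Hom_A(F, V))`. -/
def liftEquiv {F : DGModule.{u, v, w} A} (hF : F.IsSemifree) {G : DGModule.{u, v, w'} A}
    {V : DGModule.{u, v, w''} A} {q : G.carrier →ₗ[k] V.carrier} (hq : IsQuasiIso q) (n : ℤ) :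
    HomH F G n ≃ₗ[k] HomH F V n :=
  LinearEquiv.ofBijective (HomH.comp (zero_add n) (HomH.mk G V 0 ⟨q, hq.mem⟩)) (by
    constructor
    · rw [← LinearMap.ker_eq_bot, LinearMap.ker_eq_bot']
      intro x hx
      obtain ⟨β, rfl⟩ := HomH.mk_surjective x
      rw [HomH.comp_mk, HomH.mk_eq_zero_iff] at hx
      obtain ⟨α, hα, e⟩ := hx
      obtain ⟨γ, hγ, -, -, e', -⟩ := exists_lift hF hq hα
        (by rw [add_sub_cancel_right]; exact β.2) e
      exact HomH.mk_eq_zero_iff.2 ⟨γ, hγ, e'⟩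
    · intro x
      obtain ⟨α, rfl⟩ := HomH.mk_surjective x
      obtain ⟨γ, hγ, h, hh, e, e'⟩ := exists_lift hF hq α.2.1 (zero_mem _)
        (by rw [LinearMap.mem_ker.1 α.2.2, LinearMap.comp_zero])
      refine ⟨HomH.mk F G n ⟨γ, hγ, LinearMap.mem_ker.2 e⟩, ?_⟩
      rw [HomH.comp_mk, HomH.mk_eq_iff]
      exact ⟨h, hh, e'⟩)

theorem liftEquiv_apply {F : DGModule.{u, v, w} A} (hF : F.IsSemifree) {G : DGModule.{u, v, w'} A}
    {V : DGModule.{u, v, w''} A} {q : G.carrier →ₗ[k] V.carrier} (hq : IsQuasiIso q) (n : ℤ)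
    (x : HomH F G n) :
    liftEquiv hF hq n x = HomH.comp (zero_add n) (HomH.mk G V 0 ⟨q, hq.mem⟩) x := rfl

end Lifting

/-! ### Ext and composition products -/

section Ext

variable {k : Type u} [Field k] {A : DGAlgebra.{u, v} k}


variable {U : DGModule.{u, v, x₁} A} {V : DGModule.{u, v, x₂} A} {W : DGModule.{u, v, x₃} A}
  {X : DGModule.{u, v, x₄} A}

/-- `Ext^i_A(U, V) = H^i(Hom_A(F, V)) = H_{-i}(Hom_A(F, V))`, computed from a semifree resolution
`F → U`. -/
abbrev Ext (P : SemifreeResolution.{u, v, x₁, y₁} U) (V : DGModule.{u, v, x₂} A) (i : ℤ) :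
    Type (max x₂ y₁) :=
  HomH P.F V (-i)

variable (P : SemifreeResolution.{u, v, x₁, y₁} U) (Q : SemifreeResolution.{u, v, x₂, y₂} V)
  (R : SemifreeResolution.{u, v, x₃, y₃} W)

/-- For resolutions `F → U` and `G → V`, the identification of `Ext^i_A(U, V)` with the homotopy
classes of chain maps `F → G` of degree `-i`, through composition with `G → V`. -/
def Ext.equiv (i : ℤ) : HomH P.F Q.F (-i) ≃ₗ[k] Ext P V i :=
  liftEquiv P.semifree Q.quasiIso (-i)

/-- The composition product `Ext^j_A(V, W) × Ext^i_A(U, V) → Ext^n_A(U, W)`, `n = j + i`,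
`([β], [α]) ↦ [β ∘ α']`, where `α' : F → G` lifts `α : F → V` through `G → V`. -/
def Ext.mul {j i n : ℤ} (h : j + i = n) : Ext Q W j →ₗ[k] Ext P V i →ₗ[k] Ext P W n :=
  (HomH.comp (show -j + -i = -n by omega)).compl₂ (Ext.equiv P Q i).symm.toLinearMap

/-- The unit of `Ext_A(U, U)`. -/
def Ext.one : Ext P U 0 := HomH.mk P.F U (-0) ⟨P.π, by rw [neg_zero]; exact P.quasiIso.mem⟩

theorem HomH.comp_assoc {F₁ : DGModule.{u, v, w} A} {F₂ : DGModule.{u, v, w'} A} {a b c ab bc n : ℤ}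
    (h₁ : a + b = ab) (h₂ : b + c = bc) (h₃ : ab + c = n) (h₄ : a + bc = n)
    (x : HomH V W a) (y : HomH F₂ V b) (z : HomH F₁ F₂ c) :
    HomH.comp h₃ (HomH.comp h₁ x y) z = HomH.comp h₄ x (HomH.comp h₂ y z) := by
  obtain ⟨x, rfl⟩ := HomH.mk_surjective x
  obtain ⟨y, rfl⟩ := HomH.mk_surjective y
  obtain ⟨z, rfl⟩ := HomH.mk_surjective z
  rfl

theorem Ext.mul_assoc {l j i lj ji n : ℤ} (h₁ : l + j = lj) (h₂ : j + i = ji) (h₃ : lj + i = n)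
    (h₄ : l + ji = n) (γ : Ext R X l) (β : Ext Q W j) (α : Ext P V i) :
    Ext.mul P Q h₃ (Ext.mul Q R h₁ γ β) α = Ext.mul P R h₄ γ (Ext.mul P Q h₂ β α) := by
  obtain ⟨β, rfl⟩ := (Ext.equiv Q R j).surjective β
  obtain ⟨α, rfl⟩ := (Ext.equiv P Q i).surjective α
  have e : Ext.mul P Q h₂ (Ext.equiv Q R j β) (Ext.equiv P Q i α) =
      Ext.equiv P R ji (HomH.comp (by omega) β α) := by
    simp only [Ext.mul, LinearMap.compl₂_apply, LinearEquiv.coe_coe, LinearEquiv.symm_apply_apply]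
    exact HomH.comp_assoc _ _ _ _ _ _ _
  rw [e]
  simp only [Ext.mul, LinearMap.compl₂_apply, LinearEquiv.coe_coe, LinearEquiv.symm_apply_apply]
  exact HomH.comp_assoc _ _ _ _ _ _ _

theorem Ext.one_mul {i : ℤ} (α : Ext P V i) : Ext.mul P Q (zero_add i) (Ext.one Q) α = α := by
  obtain ⟨α, rfl⟩ := (Ext.equiv P Q i).surjective α
  simp only [Ext.mul, LinearMap.compl₂_apply, LinearEquiv.coe_coe, LinearEquiv.symm_apply_apply]
  rfl

theorem Ext.mul_one {i : ℤ} (α : Ext P V i) : Ext.mul P P (add_zero i) α (Ext.one P) = α := by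
  have e : (Ext.equiv P P 0).symm (Ext.one P) =
      HomH.mk P.F P.F (-0) ⟨LinearMap.id, by rw [neg_zero]; exact id_mem_homCycles _⟩ := by
    rw [LinearEquiv.symm_apply_eq]; rfl
  simp only [Ext.mul, LinearMap.compl₂_apply, LinearEquiv.coe_coe, e]
  obtain ⟨α, rfl⟩ := HomH.mk_surjective α
  rfl

/-- The graded algebra `Ext_A(U, U)` is graded-commutative: `στ = (-1)^(|σ||τ|) τσ`. -/
def Ext.IsGradedCommutative : Prop :=
  ∀ (i j n : ℤ) (hij : i + j = n) (hji : j + i = n) (σ : Ext P U i) (τ : Ext P U j),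
    Ext.mul P P hij σ τ = (-1 : k) ^ (i * j) • Ext.mul P P hji τ σ

/-- The component of degree `i` of the graded center of `Ext_A(U, U)`: the elements `c` with
`bc = (-1)^(|b||c|) cb` for all `b`. -/
def Ext.gradedCenter (i : ℤ) : Submodule k (Ext P U i) where
  carrier := {c | ∀ (j n : ℤ) (hji : j + i = n) (hij : i + j = n) (b : Ext P U j),
    Ext.mul P P hji b c = (-1 : k) ^ (j * i) • Ext.mul P P hij c b}
  add_mem' := by
    intro c c' hc hc' j n hji hij b
    rw [map_add, map_add, LinearMap.add_apply, smul_add, hc j n hji hij b, hc' j n hji hij b]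
  zero_mem' := by intro j n hji hij b; simp
  smul_mem' := by
    intro r c hc j n hji hij b
    rw [LinearMap.map_smul, LinearMap.map_smul, LinearMap.smul_apply, hc j n hji hij b, smul_comm]

end Ext

/-! ### The action of `Ext_A(k, k)` -/

section Zeta

theorem tensorGr_map_mem {k : Type u} [Field k] {M : Type v} [AddCommGroup M] [Module k M]
    {N : Type w} [AddCommGroup N] [Module k N] {gr : ℤ → Submodule k M} {gr' : ℤ → Submodule k N}
    {Q : Type w'} [AddCommGroup Q] [Module k Q] {f : M ⊗[k] N →ₗ[k] Q} {S : Submodule k Q} {n : ℤ}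
    (H : ∀ i j, ∀ x ∈ gr i, ∀ y ∈ gr' j, i + j = n → f (x ⊗ₜ y) ∈ S) {t : M ⊗[k] N}
    (ht : t ∈ tensorGr gr gr' n) : f t ∈ S := by
  have : tensorGr gr gr' n ≤ S.comap f := by
    refine Submodule.span_le.2 ?_
    rintro _ ⟨i, j, x, y, hij, hx, hy, rfl⟩
    exact H i j x hx y hy hij
  exact this ht

theorem map_tensorAct {k : Type u} [Field k] {A : DGAlgebra.{u, v} k} {U : DGModule.{u, v, w} A}
    {U' : DGModule.{u, v, w'} A} (V : DGModule.{u, v, w''} A) {n i : ℤ}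
    {f : U.carrier →ₗ[k] U'.carrier} (hf : f ∈ homSub U U' n) {t : A.carrier ⊗[k] A.carrier}
    (ht : t ∈ tensorGr A.gr A.gr i) (x : U.carrier ⊗[k] V.carrier) :
    TensorProduct.map f LinearMap.id (tensorAct U V t x) =
      (-1 : k) ^ (n * i) • tensorAct U' V t (TensorProduct.map f LinearMap.id x) := by
  induction ht using Submodule.span_induction with
  | zero => simp
  | add s t _ _ h1 h2 => simp only [map_add, LinearMap.add_apply, h1, h2, smul_add]
  | smul c t _ h => simp only [LinearMap.map_smul, LinearMap.smul_apply, h, smul_comm c]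
  | mem t ht =>
    obtain ⟨p, q, b, c, rfl, hb, hc, rfl⟩ := ht
    have key : TensorProduct.map f LinearMap.id ∘ₗ tensorAct U V (b ⊗ₜ c) =
        (-1 : k) ^ (n * (p + q)) • (tensorAct U' V (b ⊗ₜ c) ∘ₗ
          TensorProduct.map f LinearMap.id) := by
      refine tensor_ext U.isInternal V.isInternal fun r s y hy z hz => ?_
      simp only [LinearMap.comp_apply, LinearMap.smul_apply]
      rw [tensorAct_apply _ _ _ hc hy, LinearMap.map_smul, TensorProduct.map_tmul,
        TensorProduct.map_tmul, tensorAct_apply _ _ _ hc (hf.1 _ _ hy), hf.2 _ _ hb,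
        ← TensorProduct.smul_tmul', smul_smul, smul_smul, ← neg_one_zpow_add,
        ← neg_one_zpow_add]
      congr 1
      rw [show n * (p + q) + q * (r + n) = (q * r + n * p) + (n * q + n * q) by ring,
        neg_one_zpow_add k _ (n * q + n * q), neg_one_zpow_add k (n * q) (n * q),
        neg_one_zpow_mul_self, mul_one]
    exact LinearMap.congr_fun key x

variable {k : Type u} [Field k] (A : DGHopf.{u, v} k)

/-- The carrier of the DG module `k` is `k`. -/
def DGHopf.trivialEquiv : A.trivial.carrier ≃ₗ[k] k := LinearEquiv.refl k k

theorem DGHopf.trivialEquiv_smul (a : A.carrier) (c : A.trivial.carrier) :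
    A.trivialEquiv (a • c) = A.ε a * A.trivialEquiv c := rfl

/-- The carrier of the DG module `U ⊗ₖ V` is the tensor product. -/
def DGHopf.tensorEquiv (U : DGModule.{u, v, w} A.toDGAlgebra)
    (V : DGModule.{u, v, w'} A.toDGAlgebra) :
    (A.tensor U V).carrier ≃ₗ[k] U.carrier ⊗[k] V.carrier := LinearEquiv.refl k _

theorem DGHopf.tensorEquiv_smul (U : DGModule.{u, v, w} A.toDGAlgebra)
    (V : DGModule.{u, v, w'} A.toDGAlgebra) (a : A.carrier) (t : (A.tensor U V).carrier) :
    A.tensorEquiv U V (a • t) = tensorAct U V (A.Δ a) (A.tensorEquiv U V t) := rfl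

/-- The map `k ⊗ V → V`, `c ⊗ x ↦ cx`. -/
def DGHopf.leftUnit (V : DGModule.{u, v, w} A.toDGAlgebra) :
    (A.tensor A.trivial V).carrier →ₗ[k] V.carrier :=
  (TensorProduct.lid k V.carrier).toLinearMap ∘ₗ
    TensorProduct.map A.trivialEquiv.toLinearMap LinearMap.id ∘ₗ
      (A.tensorEquiv A.trivial V).toLinearMap

/-- The map `f ⊗ V : U ⊗ V → U' ⊗ V`. -/
def DGHopf.whisker {U : DGModule.{u, v, w} A.toDGAlgebra} {U' : DGModule.{u, v, w'} A.toDGAlgebra}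
    (f : U.carrier →ₗ[k] U'.carrier) (V : DGModule.{u, v, w''} A.toDGAlgebra) :
    (A.tensor U V).carrier →ₗ[k] (A.tensor U' V).carrier :=
  (A.tensorEquiv U' V).symm.toLinearMap ∘ₗ TensorProduct.map f LinearMap.id ∘ₗ
    (A.tensorEquiv U V).toLinearMap

theorem DGHopf.leftUnit_mem (V : DGModule.{u, v, w} A.toDGAlgebra) :
    A.leftUnit V ∈ homCycles (A.tensor A.trivial V) V 0 := by
  have h0 : ∀ {i : ℤ} {c : A.trivial.carrier}, c ∈ A.trivial.gr i → i ≠ 0 → c = 0 := by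
    intro i c hc hi
    change c ∈ (if i = 0 then (⊤ : Submodule k k) else ⊥) at hc
    rw [if_neg hi] at hc
    exact hc
  have hlin : ∀ t x, TensorProduct.lid k V.carrier (TensorProduct.map A.trivialEquiv.toLinearMap
      LinearMap.id (tensorAct A.trivial V t x)) =
      TensorProduct.lid k A.carrier (TensorProduct.map A.ε.toLinearMap LinearMap.id t) •
        TensorProduct.lid k V.carrier (TensorProduct.map A.trivialEquiv.toLinearMap
          LinearMap.id x) := by
    intro t x
    induction x with
    | zero => simp
    | add x y hx hy => simp only [map_add, hx, hy, smul_add]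
    | tmul c y =>
      have hc : c ∈ A.trivial.gr 0 := by
        change c ∈ (if (0 : ℤ) = 0 then (⊤ : Submodule k k) else ⊥)
        rw [if_pos rfl]; trivial
      have key : ((TensorProduct.lid k V.carrier).toLinearMap ∘ₗ
          TensorProduct.map A.trivialEquiv.toLinearMap LinearMap.id) ∘ₗ
          (tensorAct A.trivial V).flip (c ⊗ₜ y) =
          ((LinearMap.toSpanSingleton A.carrier V.carrier
            (A.trivialEquiv c • y)).restrictScalars k) ∘ₗ
          ((TensorProduct.lid k A.carrier).toLinearMap ∘ₗ
            TensorProduct.map A.ε.toLinearMap LinearMap.id) := by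
        refine tensor_ext A.toDGAlgebra.isInternal A.toDGAlgebra.isInternal
          fun i j a ha b hb => ?_
        simp only [LinearMap.comp_apply, LinearMap.flip_apply]
        rw [tensorAct_apply _ _ a hb hc]
        simp [DGHopf.trivialEquiv_smul, mul_smul, smul_comm b]
      exact LinearMap.congr_fun key t
  refine mem_homCycles ⟨?_, ?_⟩ ?_
  · intro i x hx
    change x ∈ tensorGr A.trivial.gr V.gr i at hx
    rw [add_zero]
    refine tensorGr_map_mem (f := (TensorProduct.lid k V.carrier).toLinearMap ∘ₗ
      TensorProduct.map A.trivialEquiv.toLinearMap LinearMap.id) (fun p q c hc y hy hi => ?_) hx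
    change A.trivialEquiv c • y ∈ _
    by_cases hp : p = 0
    · subst hp; rw [← hi, zero_add]; exact Submodule.smul_mem _ _ hy
    · rw [h0 hc hp, map_zero, zero_smul]; exact zero_mem _
  · intro i a ha x
    rw [zero_mul, zpow_zero, one_smul]
    refine (hlin (A.Δ a) x).trans ?_
    rw [show TensorProduct.lid k A.carrier (TensorProduct.map A.ε.toLinearMap LinearMap.id
      (A.Δ a)) = a from A.aug_comul a]
    rfl
  · intro x
    rw [zpow_zero, one_smul]
    have key : V.d ∘ₗ ((TensorProduct.lid k V.carrier).toLinearMap ∘ₗ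
          TensorProduct.map A.trivialEquiv.toLinearMap LinearMap.id) =
        ((TensorProduct.lid k V.carrier).toLinearMap ∘ₗ
          TensorProduct.map A.trivialEquiv.toLinearMap LinearMap.id) ∘ₗ
            tensorD A.trivial.isInternal A.trivial.d V.d := by
      refine tensor_ext A.trivial.isInternal V.isInternal fun i j c hc y hy => ?_
      simp only [LinearMap.comp_apply]
      rw [tensorD_tmul _ _ _ hc]
      have hd : A.trivial.d c = 0 := rfl
      rw [hd]
      by_cases hi : i = 0
      · subst hi; simp
      · rw [h0 hc hi]; simp
    exact LinearMap.congr_fun key x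

section Whisker

variable {U : DGModule.{u, v, w} A.toDGAlgebra} {U' : DGModule.{u, v, w'} A.toDGAlgebra}
  (V : DGModule.{u, v, w''} A.toDGAlgebra)

theorem DGHopf.whisker_mem_homSub {n : ℤ} {f : U.carrier →ₗ[k] U'.carrier}
    (hf : f ∈ homSub U U' n) : A.whisker f V ∈ homSub (A.tensor U V) (A.tensor U' V) n := by
  refine ⟨?_, ?_⟩
  · intro i x hx
    change x ∈ tensorGr U.gr V.gr i at hx
    change TensorProduct.map f LinearMap.id x ∈ tensorGr U'.gr V.gr (i + n)
    refine tensorGr_map_mem (fun p q c hc y hy hi => ?_) hx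
    rw [TensorProduct.map_tmul]
    exact tmul_mem_tensorGr (by omega) (hf.1 p c hc) hy
  · intro i a ha x
    exact map_tensorAct V hf (A.comul_mem ha) x

theorem DGHopf.homDiff_whisker {n : ℤ} {f : U.carrier →ₗ[k] U'.carrier}
    (hf : f ∈ homSub U U' n) :
    homDiff (A.tensor U V) (A.tensor U' V) n (A.whisker f V) =
      A.whisker (homDiff U U' n f) V := by
  refine tensor_ext U.isInternal V.isInternal fun i j x hx y hy => ?_
  change tensorD U'.isInternal U'.d V.d (f x ⊗ₜ y) - (-1 : k) ^ n •
    TensorProduct.map f LinearMap.id (tensorD U.isInternal U.d V.d (x ⊗ₜ y)) =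
    (U'.d (f x) - (-1 : k) ^ n • f (U.d x)) ⊗ₜ y
  rw [tensorD_tmul _ _ _ hx, tensorD_tmul _ _ _ (hf.1 _ _ hx), map_add, LinearMap.map_smul,
    TensorProduct.map_tmul, TensorProduct.map_tmul, TensorProduct.sub_tmul, smul_add, smul_smul,
    ← neg_one_zpow_add, add_comm n i, ← TensorProduct.smul_tmul']
  simp only [LinearMap.id_apply]
  abel

theorem DGHopf.whisker_mem {n : ℤ} {f : U.carrier →ₗ[k] U'.carrier} (hf : f ∈ homCycles U U' n) :
    A.whisker f V ∈ homCycles (A.tensor U V) (A.tensor U' V) n := by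
  refine ⟨A.whisker_mem_homSub V hf.1, LinearMap.mem_ker.2 ?_⟩
  rw [A.homDiff_whisker V hf.1, LinearMap.mem_ker.1 hf.2]
  simp [DGHopf.whisker]

/-- The map `H_n(Hom_A(U, U')) → H_n(Hom_A(U ⊗ V, U' ⊗ V))` induced by `ψ ↦ ψ ⊗ V`. -/
def HomH.whisker (n : ℤ) : HomH U U' n →ₗ[k] HomH (A.tensor U V) (A.tensor U' V) n :=
  Submodule.liftQ _ (HomH.mk (A.tensor U V) (A.tensor U' V) n ∘ₗ
    { toFun := fun f => ⟨A.whisker f.1 V, A.whisker_mem V f.2⟩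
      map_add' := fun f g => Subtype.ext (by simp [DGHopf.whisker, TensorProduct.map_add_left,
        LinearMap.add_comp, LinearMap.comp_add])
      map_smul' := fun c f => Subtype.ext (by simp [DGHopf.whisker, TensorProduct.map_smul_left,
        LinearMap.smul_comp, LinearMap.comp_smul]) })
    (by
      rintro ⟨_, _⟩ ⟨h, hh, rfl⟩
      refine LinearMap.mem_ker.2 (HomH.mk_eq_zero_iff.2 ?_)
      exact ⟨A.whisker h V, A.whisker_mem_homSub V hh, A.homDiff_whisker V hh⟩)

end Whisker

end Zeta

section ZetaMap

variable {k : Type u} [Field k] (A : DGHopf.{u, v} k)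

theorem exists_homotopy {A : DGHopf.{u, v} k} {F : DGModule.{u, v, w} A.toDGAlgebra}
    {π : F.carrier →ₗ[k] A.trivial.carrier} (hπ : IsQuasiIso π) :
    ∃ z ∈ F.gr 0, F.d z = 0 ∧ A.trivialEquiv (π z) = 1 ∧ ∃ h : F.carrier →ₗ[k] F.carrier,
      (∀ i, ∀ x ∈ F.gr i, h x ∈ F.gr (i + 1)) ∧
      ∀ x, F.d (h x) + h (F.d x) = x - A.trivialEquiv (π x) • z := by
  have h1mem : A.trivialEquiv.symm 1 ∈ A.trivial.gr 0 := by
    change (1 : k) ∈ (if (0 : ℤ) = 0 then (⊤ : Submodule k k) else ⊥)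
    rw [if_pos rfl]; trivial
  obtain ⟨z, hz, hdz, y, -, hy⟩ := hπ.surjective 0 _ h1mem rfl
  have hπz : π z = A.trivialEquiv.symm 1 := (sub_eq_zero.1 (hy.symm.trans rfl)).symm
  have hπz1 : A.trivialEquiv (π z) = 1 := by rw [hπz, LinearEquiv.apply_symm_apply]
  have hπ0 : ∀ {i : ℤ} {x : F}, x ∈ F.gr i → i ≠ 0 → π x = 0 := by
    intro i x hx hi
    have := hπ.mem.1.1 i x hx
    rw [add_zero] at this
    change π x ∈ (if i = 0 then (⊤ : Submodule k k) else ⊥) at this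
    rw [if_neg hi] at this
    exact this
  have hπd : ∀ x, π (F.d x) = 0 := fun x => by
    have := homCycles_comm hπ.mem x
    rw [zpow_zero, one_smul] at this
    exact this.symm
  -- `f = id - z π`
  let f : F.carrier →ₗ[k] F.carrier :=
    LinearMap.id - (LinearMap.toSpanSingleton k F.carrier z) ∘ₗ A.trivialEquiv.toLinearMap ∘ₗ π
  have hf : ∀ x, f x = x - A.trivialEquiv (π x) • z := fun x => rfl
  have hfgr : ∀ i, ∀ x ∈ F.gr i, f x ∈ F.gr i := by
    intro i x hx
    rw [hf]
    by_cases hi : i = 0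
    · subst hi; exact sub_mem hx (Submodule.smul_mem _ _ hz)
    · rw [hπ0 hx hi, map_zero, zero_smul, sub_zero]; exact hx
  have hfd : ∀ x, f (F.d x) = F.d x := fun x => by rw [hf, hπd]; simp
  have hdf : ∀ x, F.d (f x) = F.d x := fun x => by rw [hf]; simp [hdz]
  have hfπ : ∀ x, π (f x) = 0 := fun x => by
    apply A.trivialEquiv.injective
    rw [hf, map_sub, LinearMap.map_smul, map_sub, LinearEquiv.map_smul, hπz1]
    simp
  -- a generalized inverse of `d`, homogeneous of degree one
  obtain ⟨s, hs⟩ := F.d.rangeRestrict.exists_rightInverse_of_surjective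
    (LinearMap.range_rangeRestrict _)
  obtain ⟨t₀, ht₀⟩ := LinearMap.exists_extend s
  have ht₀d : ∀ x, F.d (t₀ (F.d x)) = F.d x := by
    intro x
    have e1 : t₀ (F.d x) = s ⟨F.d x, x, rfl⟩ := LinearMap.congr_fun ht₀ ⟨F.d x, x, rfl⟩
    have e2 := congrArg Subtype.val (LinearMap.congr_fun hs ⟨F.d x, x, rfl⟩)
    rw [e1]
    exact e2
  have hdproj : ∀ (n : ℤ) (x : F), F.d (grProj F.isInternal n x) =
      grProj F.isInternal (n - 1) (F.d x) := by
    intro n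
    have : F.d ∘ₗ grProj F.isInternal n = grProj F.isInternal (n - 1) ∘ₗ F.d := by
      refine gr_ext F.isInternal fun i x hx => ?_
      simp only [LinearMap.comp_apply]
      by_cases hi : i = n
      · subst hi; rw [grProj_same _ hx, grProj_same _ (F.d_mem hx)]
      · rw [grProj_ne _ hx hi, grProj_ne _ (F.d_mem hx) (by omega), map_zero]
    exact LinearMap.congr_fun this
  let t : F.carrier →ₗ[k] F.carrier :=
    grLift F.isInternal (fun i => grProj F.isInternal (i + 1) ∘ₗ t₀)
  have htgr : ∀ i, ∀ x ∈ F.gr i, t x ∈ F.gr (i + 1) := by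
    intro i x hx
    simp only [t]
    rw [grLift_apply _ _ hx]
    exact grProj_mem _ _ _
  have hdtd : ∀ x, F.d (t (F.d x)) = F.d x := by
    have : F.d ∘ₗ t ∘ₗ F.d = F.d := by
      refine gr_ext F.isInternal fun i x hx => ?_
      simp only [LinearMap.comp_apply, t]
      rw [grLift_apply _ _ (F.d_mem hx), LinearMap.comp_apply, hdproj, ht₀d, sub_add_cancel,
        grProj_same _ (F.d_mem hx)]
    exact LinearMap.congr_fun this
  let e : F.carrier →ₗ[k] F.carrier := LinearMap.id - t ∘ₗ F.d
  have he : ∀ x, e x = x - t (F.d x) := fun x => rfl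
  have hegr : ∀ i, ∀ x ∈ F.gr i, e x ∈ F.gr i := by
    intro i x hx
    have := htgr _ _ (F.d_mem hx)
    rw [sub_add_cancel] at this
    exact sub_mem hx this
  have hde : ∀ x, F.d (e x) = 0 := fun x => by rw [he, map_sub, hdtd, sub_self]
  have hdtfe : ∀ x, F.d (t (f (e x))) = f (e x) := by
    have : F.d ∘ₗ t ∘ₗ f ∘ₗ e = f ∘ₗ e := by
      refine gr_ext F.isInternal fun i x hx => ?_
      simp only [LinearMap.comp_apply]
      obtain ⟨c, -, hc⟩ := hπ.injective i (f (e x)) (hfgr _ _ (hegr _ _ hx))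
        (by rw [hdf, hde]) ⟨0, zero_mem _, by rw [hfπ, map_zero]⟩
      rw [← hc, hdtd]
    exact LinearMap.congr_fun this
  refine ⟨z, hz, hdz, hπz1, t ∘ₗ f ∘ₗ e + e ∘ₗ f ∘ₗ t, ?_, ?_⟩
  · intro i x hx
    exact add_mem (htgr _ _ (hfgr _ _ (hegr _ _ hx))) (hegr _ _ (hfgr _ _ (htgr _ _ hx)))
  · intro x
    simp only [LinearMap.add_apply, LinearMap.comp_apply, map_add]
    rw [hdtfe, hde, he (F.d x), F.d_d, map_zero, sub_zero, hfd, he (f (t (F.d x))), hdf, hdtd,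
      ← hf, he x, map_sub]
    abel

/-- For a semifree resolution `F → k`, the map `F ⊗ V → k ⊗ V ≅ V`. -/
def DGHopf.resMap {F : DGModule.{u, v, w} A.toDGAlgebra}
    (π : F.carrier →ₗ[k] A.trivial.carrier) (V : DGModule.{u, v, w'} A.toDGAlgebra) :
    (A.tensor F V).carrier →ₗ[k] V.carrier :=
  A.leftUnit V ∘ₗ A.whisker π V

theorem DGHopf.resMap_quasiIso {F : DGModule.{u, v, w} A.toDGAlgebra}
    {π : F.carrier →ₗ[k] A.trivial.carrier} (hπ : IsQuasiIso π)
    (V : DGModule.{u, v, w'} A.toDGAlgebra) : IsQuasiIso (A.resMap π V) := by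
  obtain ⟨z, hz, hdz, hπz, h, hh, hdh⟩ := exists_homotopy hπ
  have hmem : A.resMap π V ∈ homCycles (A.tensor F V) V 0 :=
    homCycles_comp (add_zero 0) (A.leftUnit_mem V) (A.whisker_mem V hπ.mem)
  have hR : ∀ (x : F) (y : V), A.resMap π V ((A.tensorEquiv F V).symm (x ⊗ₜ y)) =
    A.trivialEquiv (π x) • y := fun x y => rfl
  let η : V.carrier →ₗ[k] (A.tensor F V).carrier :=
    (A.tensorEquiv F V).symm.toLinearMap ∘ₗ TensorProduct.mk k F.carrier V.carrier z
  have hη : ∀ y, A.resMap π V (η y) = y := fun y => by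
    refine (hR z y).trans ?_
    rw [hπz, one_smul]
  have hηgr : ∀ n, ∀ y ∈ V.gr n, η y ∈ (A.tensor F V).gr n := fun n y hy =>
    tmul_mem_tensorGr (zero_add n) hz hy
  have hηd : ∀ y, (A.tensor F V).d (η y) = η (V.d y) := by
    intro y
    refine (tensorD_tmul F.isInternal F.d V.d hz y).trans ?_
    rw [hdz, TensorProduct.zero_tmul, zero_add, zpow_zero, one_smul]
    rfl
  let H : (A.tensor F V).carrier →ₗ[k] (A.tensor F V).carrier := A.whisker h V
  have hHgr : ∀ n, ∀ x ∈ (A.tensor F V).gr n, H x ∈ (A.tensor F V).gr (n + 1) := by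
    intro n x hx
    refine tensorGr_map_mem (f := TensorProduct.map h LinearMap.id) (fun p q x hx y hy hi => ?_) hx
    rw [TensorProduct.map_tmul]
    exact tmul_mem_tensorGr (by omega) (hh p x hx) hy
  have hH : ∀ x, (A.tensor F V).d (H x) + H ((A.tensor F V).d x) = x - η (A.resMap π V x) := by
    have : (A.tensor F V).d ∘ₗ H + H ∘ₗ (A.tensor F V).d =
        LinearMap.id - η ∘ₗ A.resMap π V := by
      refine tensor_ext F.isInternal V.isInternal fun i j x hx y hy => ?_
      change tensorD F.isInternal F.d V.d (h x ⊗ₜ y) +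
        TensorProduct.map h LinearMap.id (tensorD F.isInternal F.d V.d (x ⊗ₜ y)) =
        x ⊗ₜ y - z ⊗ₜ (A.trivialEquiv (π x) • y)
      rw [tensorD_tmul _ _ _ hx, tensorD_tmul _ _ _ (hh _ _ hx), map_add, LinearMap.map_smul,
        TensorProduct.map_tmul, TensorProduct.map_tmul, neg_one_zpow_add_one,
        ← TensorProduct.smul_tmul, ← TensorProduct.sub_tmul, ← hdh x, TensorProduct.add_tmul,
        neg_smul]
      simp only [LinearMap.id_apply]
      abel
    exact LinearMap.congr_fun this
  refine ⟨hmem, ?_, ?_⟩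
  · rintro n x hx hdx ⟨y, hy, hyx⟩
    refine ⟨η y + H x, add_mem (hηgr _ _ hy) (hHgr _ _ hx), ?_⟩
    have := hH x
    rw [hdx, map_zero, add_zero] at this
    rw [map_add, hηd, hyx, this]
    abel
  · intro n y hy hdy
    refine ⟨η y, hηgr _ _ hy, by rw [hηd, hdy, map_zero], 0, zero_mem _, ?_⟩
    rw [hη, sub_self, map_zero]


variable {V : DGModule.{u, v, x₂} A.toDGAlgebra}
  (P : SemifreeResolution.{u, v, u, y₁} A.trivial) (Q : SemifreeResolution.{u, v, x₂, y₂} V)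

/-- For semifree resolutions `F → k` and `G → V`, the class of a homotopy inverse `G → F ⊗ G` of
`F ⊗ G → k ⊗ G ≅ G`. -/
def DGHopf.resInv : HomH Q.F (A.tensor P.F Q.F) 0 :=
  (liftEquiv Q.semifree (A.resMap_quasiIso P.quasiIso Q.F) 0).symm (HomH.id Q.F)

/-- For semifree resolutions `F → k` and `G → V`, the map
`H_n(Hom_A(F ⊗ G, F ⊗ G)) → H_n(Hom_A(G, G))` given by conjugation with the homotopy equivalence
`F ⊗ G → G`. -/
def DGHopf.resConj (n : ℤ) :
    HomH (A.tensor P.F Q.F) (A.tensor P.F Q.F) n →ₗ[k] HomH Q.F Q.F n :=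
  HomH.comp (zero_add n) (HomH.mk _ _ 0 ⟨A.resMap P.π Q.F, (A.resMap_quasiIso P.quasiIso Q.F).mem⟩)
    ∘ₗ (HomH.comp (add_zero n)).flip (A.resInv P Q)

/-- The map `ζ_V : Ext_A(k, k) → Ext_A(V, V)` induced by `ψ ↦ ψ ⊗ G`, for semifree resolutions
`F → k` and `G → V`: the composition
`H(Hom_A(F, k)) ≅ H(Hom_A(F, F)) → H(Hom_A(F ⊗ G, F ⊗ G)) → H(Hom_A(G, G)) ≅ H(Hom_A(G, V))`. -/
def DGHopf.zeta (i : ℤ) : Ext P A.trivial i →ₗ[k] Ext Q V i :=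
  (Ext.equiv Q Q i).toLinearMap ∘ₗ A.resConj P Q (-i) ∘ₗ HomH.whisker A Q.F (-i) ∘ₗ
    (Ext.equiv P P i).symm.toLinearMap

theorem HomH.whisker_comp {F : DGModule.{u, v, w} A.toDGAlgebra}
    (V : DGModule.{u, v, w'} A.toDGAlgebra) {a b n : ℤ} (h : a + b = n) (x : HomH F F a)
    (y : HomH F F b) : HomH.whisker A V n (HomH.comp h x y) =
      HomH.comp h (HomH.whisker A V a x) (HomH.whisker A V b y) := by
  obtain ⟨x, rfl⟩ := HomH.mk_surjective x
  obtain ⟨y, rfl⟩ := HomH.mk_surjective y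
  refine congrArg (HomH.mk _ _ n) (Subtype.ext ?_)
  refine tensor_ext F.isInternal V.isInternal fun i j x hx y hy => ?_
  rfl

theorem DGHopf.resMap_comp_resInv :
    HomH.comp (zero_add 0) (HomH.mk _ _ 0 ⟨A.resMap P.π Q.F,
      (A.resMap_quasiIso P.quasiIso Q.F).mem⟩) (A.resInv P Q) = HomH.id Q.F :=
  LinearEquiv.apply_symm_apply (liftEquiv Q.semifree (A.resMap_quasiIso P.quasiIso Q.F) 0) _

theorem HomH.id_comp {U : DGModule.{u, v, w} A.toDGAlgebra} {V : DGModule.{u, v, w'} A.toDGAlgebra}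
    {n : ℤ} (x : HomH U V n) : HomH.comp (zero_add n) (HomH.id V) x = x := by
  obtain ⟨x, rfl⟩ := HomH.mk_surjective x
  rfl

theorem DGHopf.resConj_comp {a b n : ℤ} (h : a + b = n)
    (x : HomH (A.tensor P.F Q.F) (A.tensor P.F Q.F) a)
    (y : HomH (A.tensor P.F Q.F) (A.tensor P.F Q.F) b) :
    A.resConj P Q n (HomH.comp h x y) =
      HomH.comp h (A.resConj P Q a x) (A.resConj P Q b y) := by
  have e : HomH.comp (zero_add b) (A.resInv P Q) (A.resConj P Q b y) =
      HomH.comp (add_zero b) y (A.resInv P Q) := by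
    apply (liftEquiv Q.semifree (A.resMap_quasiIso P.quasiIso Q.F) b).injective
    rw [liftEquiv_apply, liftEquiv_apply,
      ← HomH.comp_assoc (zero_add 0) (zero_add b) (zero_add b) (zero_add b),
      A.resMap_comp_resInv, HomH.id_comp]
    rfl
  simp only [DGHopf.resConj, LinearMap.comp_apply, LinearMap.flip_apply] at e ⊢
  rw [HomH.comp_assoc (zero_add a) h h (zero_add n), HomH.comp_assoc (add_zero a) (zero_add b) h h,
    e, HomH.comp_assoc h (add_zero b) (add_zero n) h]

/-- `ζ_V` is multiplicative. -/
theorem DGHopf.zeta_mul {i j n : ℤ} (h : i + j = n) (σ : Ext P A.trivial i)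
    (τ : Ext P A.trivial j) : A.zeta P Q n (Ext.mul P P h σ τ) =
      Ext.mul Q Q h (A.zeta P Q i σ) (A.zeta P Q j τ) := by
  obtain ⟨σ, rfl⟩ := (Ext.equiv P P i).surjective σ
  obtain ⟨τ, rfl⟩ := (Ext.equiv P P j).surjective τ
  have e : Ext.mul P P h (Ext.equiv P P i σ) (Ext.equiv P P j τ) =
      Ext.equiv P P n (HomH.comp (by omega) σ τ) := by
    simp only [Ext.mul, LinearMap.compl₂_apply, LinearEquiv.coe_coe, LinearEquiv.symm_apply_apply]
    exact HomH.comp_assoc _ _ _ _ _ _ _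
  rw [e]
  simp only [DGHopf.zeta, Ext.mul, LinearMap.compl₂_apply, LinearEquiv.coe_coe,
    LinearMap.comp_apply, LinearEquiv.symm_apply_apply]
  rw [HomH.whisker_comp, A.resConj_comp]
  exact (HomH.comp_assoc _ _ _ _ _ _ _).symm

/-- `ζ_V` is unital. -/
theorem DGHopf.zeta_one : A.zeta P Q 0 (Ext.one P) = Ext.one Q := by
  have e : (Ext.equiv P P 0).symm (Ext.one P) = HomH.id P.F := by
    rw [LinearEquiv.symm_apply_eq]; rfl
  have e2 : HomH.whisker A Q.F 0 (HomH.id P.F) = HomH.id (A.tensor P.F Q.F) := by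
    refine congrArg (HomH.mk _ _ 0) (Subtype.ext ?_)
    exact tensor_ext P.F.isInternal Q.F.isInternal fun i j x hx y hy => rfl
  have e3 : A.resConj P Q 0 (HomH.id (A.tensor P.F Q.F)) = HomH.id Q.F := by
    refine Eq.trans ?_ (A.resMap_comp_resInv P Q)
    simp only [DGHopf.resConj, LinearMap.comp_apply, LinearMap.flip_apply]
    rw [HomH.id_comp]
  simp only [DGHopf.zeta, LinearMap.comp_apply, LinearEquiv.coe_coe]
  rw [e]
  refine (congrArg _ ((congrArg _ e2).trans e3)).trans ?_
  rfl

variable {U : DGModule.{u, v, x₁} A.toDGAlgebra} (R : SemifreeResolution.{u, v, x₁, y₃} U)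

/-- The left `S`-action on `Ext_A(U, V)` induced through `ζ_V` from the left action of
`Ext_A(V, V)`: `σ · μ = ζ_V(σ) μ`. -/
def DGHopf.actLeft {i j n : ℤ} (h : i + j = n) (σ : Ext P A.trivial i) (μ : Ext R V j) :
    Ext R V n :=
  Ext.mul R Q h (A.zeta P Q i σ) μ

/-- The left `S`-action on `Ext_A(U, V)` induced through `ζ_U` from the right action of
`Ext_A(U, U)`: `σ · μ = (-1)^(|σ||μ|) μ ζ_U(σ)`. -/
def DGHopf.actRight {i j n : ℤ} (h : i + j = n) (σ : Ext P A.trivial i) (μ : Ext R V j) :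
    Ext R V n :=
  (-1 : k) ^ (i * j) • Ext.mul R R (show j + i = n by omega) μ (A.zeta P R i σ)

end ZetaMap

end DG

end

/-!
The maps `ψ ⊗ G` and `F ⊗ β` commute up to the sign `(-1)^(|ψ||β|)`, and this is the source of all
three claims. Fix semifree resolutions `F → k`, `G → V` and `G' → U`.

A chain map `β : G' → G` of degree `n` induces a chain map
`F ⊗ β : x ⊗ y ↦ (-1)^(n|x|) x ⊗ β y` (`DGHopf.leftWhisker`), and the homotopy equivalences
`F ⊗ G → G` are natural for such maps on the nose (`DGHopf.resMap_comp_leftWhisker`). Lifting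
uniquely along the quasi-isomorphism `F ⊗ G → G` makes their homotopy inverses natural up to
homotopy, and hence `ζ_V(σ) μ = (-1)^(|σ||μ|) μ ζ_U(σ)` (`DGHopf.actLeft_eq_actRight`). Taking
`U = V` and equal resolutions gives centrality.

Graded-commutativity of `Ext_A(k, k)` is centrality for `V = k`, because `ζ_k` is the identity
(`DGHopf.zeta_trivial`). Besides `λ : F ⊗ F → k ⊗ F = F` there is `ρ : F ⊗ F → F ⊗ k = F`
(`DGHopf.rightResMap`), and `π λ = π ρ` for the resolution `π : F → k`. If `η` is a homotopy inverse
of `λ`, then `π ρ η = π λ η ∼ π`, so `ρ η ∼ id` because `π` is a quasi-isomorphism and `F` is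
semifree. Since `ρ` intertwines `ψ ⊗ F` and `ψ`,
`π λ (ψ ⊗ F) η = π ρ (ψ ⊗ F) η = π ψ ρ η ∼ π ψ`.
This does not use that `F ⊗ F` is semifree, nor coassociativity of `Δ`.
-/

namespace DG

variable {k : Type u} [Field k]

/-- `F ⊗ β` intertwines the actions of `A ⊗ A`, up to the Koszul sign. -/
theorem map_sgnMap_tensorAct {A : DGAlgebra.{u, v} k} (F : DGModule.{u, v, w} A)
    {V : DGModule.{u, v, w'} A} {V' : DGModule.{u, v, w''} A} {n i : ℤ}
    {β : V.carrier →ₗ[k] V'.carrier} (hβ : β ∈ homSub V V' n) {t : A.carrier ⊗[k] A.carrier}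
    (ht : t ∈ tensorGr A.gr A.gr i) (x : F.carrier ⊗[k] V.carrier) :
    TensorProduct.map (sgnMap F.isInternal n) β (tensorAct F V t x) =
      (-1 : k) ^ (n * i) •
        tensorAct F V' t (TensorProduct.map (sgnMap F.isInternal n) β x) := by
  induction ht using Submodule.span_induction with
  | zero => simp
  | add s t _ _ h1 h2 => simp only [map_add, LinearMap.add_apply, h1, h2, smul_add]
  | smul c t _ h => simp only [LinearMap.map_smul, LinearMap.smul_apply, h, smul_comm c]
  | mem t ht =>
    obtain ⟨p, q, b, c, rfl, hb, hc, rfl⟩ := ht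
    have key : TensorProduct.map (sgnMap F.isInternal n) β ∘ₗ tensorAct F V (b ⊗ₜ c) =
        (-1 : k) ^ (n * (p + q)) • (tensorAct F V' (b ⊗ₜ c) ∘ₗ
          TensorProduct.map (sgnMap F.isInternal n) β) := by
      refine tensor_ext F.isInternal V.isInternal fun r s y hy z hz => ?_
      simp only [LinearMap.comp_apply, LinearMap.smul_apply]
      rw [tensorAct_apply _ _ _ hc hy, LinearMap.map_smul, TensorProduct.map_tmul,
        TensorProduct.map_tmul, sgnMap_apply _ _ (F.smul_mem hb hy), sgnMap_apply _ _ hy,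
        hβ.2 _ _ hc, ← TensorProduct.smul_tmul' ((-1 : k) ^ (n * (p + r))),
        ← TensorProduct.smul_tmul' ((-1 : k) ^ (n * r)),
        LinearMap.map_smul (tensorAct F V' (b ⊗ₜ c)), tensorAct_apply _ _ _ hc hy,
        TensorProduct.tmul_smul]
      simp only [smul_smul, ← neg_one_zpow_add]
      congr 2
      ring
    exact LinearMap.congr_fun key x

namespace DGHopf

variable (A : DGHopf.{u, v} k)

/-! ### The functor `F ⊗ -` on graded maps -/

/-- The map `F ⊗ β : x ⊗ y ↦ (-1)^(n|x|) x ⊗ β y`, for `β` of degree `n`. The degree is an explicit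
argument, since it cannot be read off from the underlying linear map. -/
noncomputable def leftWhisker (F : DGModule.{u, v, w} A.toDGAlgebra)
    {V : DGModule.{u, v, w'} A.toDGAlgebra}
    {V' : DGModule.{u, v, w''} A.toDGAlgebra} (n : ℤ) (β : V.carrier →ₗ[k] V'.carrier) :
    (A.tensor F V).carrier →ₗ[k] (A.tensor F V').carrier :=
  (A.tensorEquiv F V').symm.toLinearMap ∘ₗ TensorProduct.map (sgnMap F.isInternal n) β ∘ₗ
    (A.tensorEquiv F V).toLinearMap

section LeftWhisker

variable {F : DGModule.{u, v, w} A.toDGAlgebra} {V : DGModule.{u, v, w'} A.toDGAlgebra}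
  {V' : DGModule.{u, v, w''} A.toDGAlgebra}

theorem leftWhisker_mem {n : ℤ} {β : V.carrier →ₗ[k] V'.carrier} (hβ : β ∈ homCycles V V' n) :
    A.leftWhisker F n β ∈ homCycles (A.tensor F V) (A.tensor F V') n := by
  refine mem_homCycles ⟨?_, ?_⟩ ?_
  · intro i x hx
    change x ∈ tensorGr F.gr V.gr i at hx
    change TensorProduct.map (sgnMap F.isInternal n) β x ∈ tensorGr F.gr V'.gr (i + n)
    refine tensorGr_map_mem (fun p q c hc y hy hi => ?_) hx
    rw [TensorProduct.map_tmul, sgnMap_apply _ _ hc]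
    exact tmul_mem_tensorGr (by omega) (Submodule.smul_mem _ _ hc) (hβ.1.1 q y hy)
  · intro i a ha x
    exact map_sgnMap_tensorAct F hβ.1 (A.comul_mem ha) x
  · have key : tensorD F.isInternal F.d V'.d ∘ₗ TensorProduct.map (sgnMap F.isInternal n) β =
        (-1 : k) ^ n • (TensorProduct.map (sgnMap F.isInternal n) β ∘ₗ
          tensorD F.isInternal F.d V.d) := by
      refine tensor_ext F.isInternal V.isInternal fun i j x hx y hy => ?_
      simp only [LinearMap.comp_apply, LinearMap.smul_apply]
      rw [tensorD_tmul _ _ _ hx, map_add, LinearMap.map_smul]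
      simp only [TensorProduct.map_tmul]
      rw [sgnMap_apply _ _ hx, sgnMap_apply _ _ (F.d_mem hx), ← TensorProduct.smul_tmul',
        LinearMap.map_smul, tensorD_tmul _ _ _ hx, homCycles_comm hβ]
      simp only [← TensorProduct.smul_tmul', TensorProduct.tmul_smul, smul_add, smul_smul,
        ← neg_one_zpow_add]
      rw [show n + n * (i - 1) = n * i by ring,
        show n * i + (i + n) = n + (i + n * i) by ring]
    exact LinearMap.congr_fun key

/-- The Koszul sign rule `(ψ ⊗ V')(F ⊗ β) = (-1)^(|ψ||β|) (F' ⊗ β)(ψ ⊗ V)`. -/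
theorem whisker_comp_leftWhisker {F' : DGModule.{u, v, x₁} A.toDGAlgebra} {m n : ℤ}
    {ψ : F.carrier →ₗ[k] F'.carrier} (hψ : ψ ∈ homSub F F' m) (β : V.carrier →ₗ[k] V'.carrier) :
    A.whisker ψ V' ∘ₗ A.leftWhisker F n β =
      (-1 : k) ^ (m * n) • (A.leftWhisker F' n β ∘ₗ A.whisker ψ V) := by
  refine tensor_ext F.isInternal V.isInternal fun i j x hx y hy => ?_
  change TensorProduct.map ψ LinearMap.id (sgnMap F.isInternal n x ⊗ₜ β y) =
    (-1 : k) ^ (m * n) • (sgnMap F'.isInternal n (ψ x) ⊗ₜ β y)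
  rw [sgnMap_apply _ _ hx, sgnMap_apply _ _ (hψ.1 _ _ hx), TensorProduct.map_tmul,
    LinearMap.map_smul, ← TensorProduct.smul_tmul', ← TensorProduct.smul_tmul', smul_smul,
    ← neg_one_zpow_add, show m * n + n * (i + m) = n * i + (n * m + n * m) by ring,
    neg_one_zpow_add, neg_one_zpow_add k (n * m), neg_one_zpow_mul_self, mul_one]
  rfl

end LeftWhisker

/-! ### Maps to the trivial module -/

theorem trivial_eq_zero {i : ℤ} {c : A.trivial.carrier} (hc : c ∈ A.trivial.gr i) (hi : i ≠ 0) :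
    c = 0 := by
  change c ∈ (if i = 0 then (⊤ : Submodule k k) else ⊥) at hc
  rw [if_neg hi] at hc
  exact hc

theorem map_trivial_eq_zero {F : DGModule.{u, v, w} A.toDGAlgebra}
    {π : F.carrier →ₗ[k] A.trivial.carrier} (hπ : π ∈ homCycles F A.trivial 0) {i : ℤ} {x : F}
    (hx : x ∈ F.gr i) (hi : i ≠ 0) : π x = 0 :=
  A.trivial_eq_zero (hπ.1.1 i x hx) (by rwa [add_zero])

theorem map_trivial_d {F : DGModule.{u, v, w} A.toDGAlgebra}
    {π : F.carrier →ₗ[k] A.trivial.carrier} (hπ : π ∈ homCycles F A.trivial 0) (x : F) :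
    π (F.d x) = 0 := by
  have := homCycles_comm hπ x
  rw [zpow_zero, one_smul] at this
  exact this.symm

theorem resMap_tmul {F : DGModule.{u, v, w} A.toDGAlgebra} (π : F.carrier →ₗ[k] A.trivial.carrier)
    (V : DGModule.{u, v, w'} A.toDGAlgebra) (x : F) (y : V) :
    A.resMap π V ((A.tensorEquiv F V).symm (x ⊗ₜ y)) = A.trivialEquiv (π x) • y := rfl

/-- The maps `F ⊗ V → V` are natural in `V`. There is no sign, because `π x = 0` unless
`|x| = 0`. -/
theorem resMap_comp_leftWhisker {F : DGModule.{u, v, w} A.toDGAlgebra}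
    {V : DGModule.{u, v, w'} A.toDGAlgebra} {V' : DGModule.{u, v, w''} A.toDGAlgebra}
    {π : F.carrier →ₗ[k] A.trivial.carrier} (hπ : π ∈ homCycles F A.trivial 0) (n : ℤ)
    (β : V.carrier →ₗ[k] V'.carrier) :
    A.resMap π V' ∘ₗ A.leftWhisker F n β = β ∘ₗ A.resMap π V := by
  refine tensor_ext F.isInternal V.isInternal fun i j x hx y hy => ?_
  change A.trivialEquiv (π (sgnMap F.isInternal n x)) • β y = β (A.trivialEquiv (π x) • y)
  rw [sgnMap_apply _ _ hx, LinearMap.map_smul β]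
  rcases eq_or_ne i 0 with rfl | hi
  · rw [mul_zero, zpow_zero, one_smul]
  · rw [LinearMap.map_smul, A.map_trivial_eq_zero hπ hx hi, smul_zero, map_zero, zero_smul]

/-- For `π : F → k`, the map `V ⊗ F → V ⊗ k ≅ V`. -/
noncomputable def rightResMap {F : DGModule.{u, v, w} A.toDGAlgebra}
    (π : F.carrier →ₗ[k] A.trivial.carrier)
    (V : DGModule.{u, v, w'} A.toDGAlgebra) : (A.tensor V F).carrier →ₗ[k] V.carrier :=
  (TensorProduct.rid k V.carrier).toLinearMap ∘ₗ
    TensorProduct.map LinearMap.id (A.trivialEquiv.toLinearMap ∘ₗ π) ∘ₗ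
      (A.tensorEquiv V F).toLinearMap

section RightResMap

variable {F : DGModule.{u, v, w} A.toDGAlgebra} {π : F.carrier →ₗ[k] A.trivial.carrier}
  (V : DGModule.{u, v, w'} A.toDGAlgebra)

theorem rightResMap_tmul (x : V) (y : F) :
    A.rightResMap π V ((A.tensorEquiv V F).symm (x ⊗ₜ y)) = A.trivialEquiv (π y) • x :=
  TensorProduct.rid_tmul _ _

theorem rightResMap_tensorAct (hπ : π ∈ homCycles F A.trivial 0)
    (t : A.carrier ⊗[k] A.carrier) (x : V.carrier ⊗[k] F.carrier) :
    A.rightResMap π V ((A.tensorEquiv V F).symm (tensorAct V F t x)) =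
      TensorProduct.rid k A.carrier (TensorProduct.map LinearMap.id A.ε.toLinearMap t) •
        A.rightResMap π V ((A.tensorEquiv V F).symm x) := by
  let T : A.carrier ⊗[k] A.carrier →ₗ[k] V.carrier ⊗[k] F.carrier →ₗ[k] V.carrier :=
    (tensorAct V F).compr₂ (A.rightResMap π V ∘ₗ (A.tensorEquiv V F).symm.toLinearMap)
  let T' : A.carrier ⊗[k] A.carrier →ₗ[k] V.carrier ⊗[k] F.carrier →ₗ[k] V.carrier :=
    (Algebra.lsmul k k V.carrier : A.carrier →ₐ[k] Module.End k V.carrier).toLinearMap.compl₁₂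
      ((TensorProduct.rid k A.carrier).toLinearMap ∘ₗ
        TensorProduct.map LinearMap.id A.ε.toLinearMap)
      (A.rightResMap π V ∘ₗ (A.tensorEquiv V F).symm.toLinearMap)
  have key : T = T' := by
    refine tensor_ext A.toDGAlgebra.isInternal A.toDGAlgebra.isInternal fun i j a ha b hb => ?_
    refine tensor_ext V.isInternal F.isInternal fun p q y hy z hz => ?_
    change A.rightResMap π V ((A.tensorEquiv V F).symm (tensorAct V F (a ⊗ₜ b) (y ⊗ₜ z))) =
      TensorProduct.rid k A.carrier (a ⊗ₜ A.ε b) •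
        A.rightResMap π V ((A.tensorEquiv V F).symm (y ⊗ₜ z))
    have hπb : π (b • z) = b • π z := by
      rw [hπ.1.2 _ _ hb, zero_mul, zpow_zero, one_smul]
    rw [tensorAct_apply _ _ _ hb hy, LinearEquiv.map_smul, LinearMap.map_smul, rightResMap_tmul,
      rightResMap_tmul, hπb, trivialEquiv_smul, TensorProduct.rid_tmul]
    rcases eq_or_ne j 0 with rfl | hj
    · rw [zero_mul, zpow_zero, one_smul, mul_smul, smul_assoc, smul_comm a]
    · rw [A.ε_of_ne hj hb]
      simp
  exact LinearMap.congr_fun₂ key t x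

theorem rightResMap_mem (hπ : π ∈ homCycles F A.trivial 0) :
    A.rightResMap π V ∈ homCycles (A.tensor V F) V 0 := by
  refine mem_homCycles ⟨?_, ?_⟩ ?_
  · intro i x hx
    change x ∈ tensorGr V.gr F.gr i at hx
    rw [add_zero]
    refine tensorGr_map_mem (f := A.rightResMap π V ∘ₗ (A.tensorEquiv V F).symm.toLinearMap)
      (fun p q y hy z hz hi => ?_) hx
    refine (A.rightResMap_tmul V y z).symm ▸ ?_
    rcases eq_or_ne q 0 with rfl | hq
    · rw [← hi, add_zero]; exact Submodule.smul_mem _ _ hy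
    · rw [A.map_trivial_eq_zero hπ hz hq, map_zero, zero_smul]; exact zero_mem _
  · intro i a ha x
    rw [zero_mul, zpow_zero, one_smul]
    refine (A.rightResMap_tensorAct V hπ (A.Δ a) x).trans ?_
    rw [show TensorProduct.rid k A.carrier (TensorProduct.map LinearMap.id A.ε.toLinearMap
      (A.Δ a)) = a from A.comul_aug a]
    rfl
  · intro x
    rw [zpow_zero, one_smul]
    have key : V.d ∘ₗ A.rightResMap π V = A.rightResMap π V ∘ₗ (A.tensor V F).d := by
      refine tensor_ext V.isInternal F.isInternal fun i j y hy z hz => ?_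
      change V.d (A.rightResMap π V ((A.tensorEquiv V F).symm (y ⊗ₜ z))) = A.rightResMap π V
        ((A.tensorEquiv V F).symm (tensorD V.isInternal V.d F.d (y ⊗ₜ z)))
      rw [tensorD_tmul _ _ _ hy, map_add, map_add, LinearEquiv.map_smul, LinearMap.map_smul,
        rightResMap_tmul, rightResMap_tmul, rightResMap_tmul, A.map_trivial_d hπ, map_zero,
        zero_smul, smul_zero, add_zero, LinearMap.map_smul]
    exact LinearMap.congr_fun key x

/-- The maps `V ⊗ F → V` are natural in `V`. -/
theorem rightResMap_comp_whisker {V} {V' : DGModule.{u, v, w''} A.toDGAlgebra}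
    (ψ : V.carrier →ₗ[k] V'.carrier) :
    A.rightResMap π V' ∘ₗ A.whisker ψ F = ψ ∘ₗ A.rightResMap π V := by
  refine tensor_ext V.isInternal F.isInternal fun i j x hx y hy => ?_
  exact ((A.rightResMap_tmul V' (ψ x) y).trans (LinearMap.map_smul ψ _ _).symm).trans
    (congrArg ψ (A.rightResMap_tmul V x y).symm)

/-- The two maps `F ⊗ F → F` agree after composition with `π : F → k`: both become
`x ⊗ y ↦ π(x) π(y)`. -/
theorem comp_resMap_eq_comp_rightResMap (π : F.carrier →ₗ[k] A.trivial.carrier) :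
    π ∘ₗ A.resMap π F = π ∘ₗ A.rightResMap π F := by
  refine tensor_ext F.isInternal F.isInternal fun i j x hx y hy => ?_
  change π (A.resMap π F ((A.tensorEquiv F F).symm (x ⊗ₜ y))) =
    π (A.rightResMap π F ((A.tensorEquiv F F).symm (x ⊗ₜ y)))
  rw [resMap_tmul, rightResMap_tmul, LinearMap.map_smul, LinearMap.map_smul]
  exact mul_comm (A.trivialEquiv (π x)) (A.trivialEquiv (π y))

end RightResMap

/-! ### Naturality of the conjugation -/

section Conjugation

variable {V : DGModule.{u, v, x₂} A.toDGAlgebra} {U : DGModule.{u, v, x₁} A.toDGAlgebra}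
  (P : SemifreeResolution.{u, v, u, y₁} A.trivial) (Q : SemifreeResolution.{u, v, x₂, y₂} V)
  (R : SemifreeResolution.{u, v, x₁, y₃} U)

/-- The class of the homotopy equivalence `F ⊗ G → k ⊗ G ≅ G`. -/
noncomputable def resClass : HomH (A.tensor P.F Q.F) Q.F 0 :=
  HomH.mk _ _ 0 ⟨A.resMap P.π Q.F, (A.resMap_quasiIso P.quasiIso Q.F).mem⟩

theorem resConj_apply (n : ℤ) (x : HomH (A.tensor P.F Q.F) (A.tensor P.F Q.F) n) :
    A.resConj P Q n x =
      HomH.comp (zero_add n) (A.resClass P Q) (HomH.comp (add_zero n) x (A.resInv P Q)) := rfl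

/-- The homotopy inverses `G → F ⊗ G` are natural in `G` up to homotopy. -/
theorem resInv_comp {n : ℤ} (β : ↥(homCycles R.F Q.F n)) :
    HomH.comp (zero_add n) (A.resInv P Q) (HomH.mk _ _ n β) =
      HomH.comp (add_zero n)
        (HomH.mk _ _ n ⟨A.leftWhisker P.F n β.1, A.leftWhisker_mem β.2⟩) (A.resInv P R) := by
  have natural : HomH.comp (zero_add n) (A.resClass P Q)
      (HomH.mk _ _ n ⟨A.leftWhisker P.F n β.1, A.leftWhisker_mem β.2⟩) =
      HomH.comp (add_zero n) (HomH.mk _ _ n β) (A.resClass P R) :=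
    congrArg (HomH.mk _ _ n)
      (Subtype.ext (A.resMap_comp_leftWhisker P.quasiIso.mem n β.1))
  apply (liftEquiv R.semifree (A.resMap_quasiIso P.quasiIso Q.F) n).injective
  rw [liftEquiv_apply, liftEquiv_apply]
  change HomH.comp _ (A.resClass P Q) _ = HomH.comp _ (A.resClass P Q) _
  rw [← HomH.comp_assoc (zero_add 0) (zero_add n) (zero_add n) (zero_add n),
    ← HomH.comp_assoc (zero_add n) (add_zero n) (add_zero n) (zero_add n), natural,
    HomH.comp_assoc (add_zero n) (zero_add 0) (add_zero n) (add_zero n),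
    show HomH.comp (zero_add 0) (A.resClass P Q) (A.resInv P Q) = HomH.id Q.F from
      A.resMap_comp_resInv P Q,
    show HomH.comp (zero_add 0) (A.resClass P R) (A.resInv P R) = HomH.id R.F from
      A.resMap_comp_resInv P R]
  rfl

theorem resConj_whisker_comp {a b n : ℤ} (h : a + b = n) (h' : b + a = n) (x : HomH P.F P.F a)
    (y : HomH R.F Q.F b) :
    HomH.comp h (A.resConj P Q a (HomH.whisker A Q.F a x)) y =
      (-1 : k) ^ (a * b) • HomH.comp h' y (A.resConj P R a (HomH.whisker A R.F a x)) := by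
  obtain ⟨ψ, rfl⟩ := HomH.mk_surjective x
  obtain ⟨β, rfl⟩ := HomH.mk_surjective y
  let Fβ : HomH (A.tensor P.F R.F) (A.tensor P.F Q.F) b :=
    HomH.mk _ _ b ⟨A.leftWhisker P.F b β.1, A.leftWhisker_mem β.2⟩
  have natural : HomH.comp (zero_add b) (A.resClass P Q) Fβ =
      HomH.comp (add_zero b) (HomH.mk _ _ b β) (A.resClass P R) :=
    congrArg (HomH.mk _ _ b)
      (Subtype.ext (A.resMap_comp_leftWhisker P.quasiIso.mem b β.1))
  have koszul : HomH.comp h (HomH.whisker A Q.F a (HomH.mk _ _ a ψ)) Fβ =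
      (-1 : k) ^ (a * b) • HomH.comp h' Fβ (HomH.whisker A R.F a (HomH.mk _ _ a ψ)) :=
    (congrArg (HomH.mk _ _ n)
      (Subtype.ext (A.whisker_comp_leftWhisker ψ.2.1 β.1))).trans (LinearMap.map_smul _ _ _)
  rw [resConj_apply, resConj_apply,
    HomH.comp_assoc (zero_add a) h h (zero_add n),
    HomH.comp_assoc (add_zero a) (zero_add b) h h, A.resInv_comp P Q R β,
    ← HomH.comp_assoc h (add_zero b) (add_zero n) h, koszul, LinearMap.map_smul,
    LinearMap.smul_apply, LinearMap.map_smul]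
  congr 1
  rw [HomH.comp_assoc h' (add_zero a) (add_zero n) h',
    ← HomH.comp_assoc (zero_add b) h' h' (zero_add n), natural,
    HomH.comp_assoc (add_zero b) (zero_add a) h' h']

end Conjugation

/-! ### The maps `ζ` -/

section Zeta

variable {V : DGModule.{u, v, x₂} A.toDGAlgebra} {U : DGModule.{u, v, x₁} A.toDGAlgebra}
  (P : SemifreeResolution.{u, v, u, y₁} A.trivial) (Q : SemifreeResolution.{u, v, x₂, y₂} V)
  (R : SemifreeResolution.{u, v, x₁, y₃} U)

theorem actLeft_eq_actRight {i j n : ℤ} (h : i + j = n) (σ : Ext P A.trivial i)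
    (μ : Ext R V j) : A.actLeft P Q R h σ μ = A.actRight P R h σ μ := by
  obtain ⟨σ, rfl⟩ := (Ext.equiv P P i).surjective σ
  obtain ⟨μ, rfl⟩ := (Ext.equiv R Q j).surjective μ
  simp only [actLeft, actRight, zeta, Ext.mul, LinearMap.compl₂_apply, LinearEquiv.coe_coe,
    LinearMap.comp_apply, LinearEquiv.symm_apply_apply]
  simp only [Ext.equiv, liftEquiv_apply]
  rw [HomH.comp_assoc (zero_add (-i)) (show -i + -j = -n by omega) _ (zero_add (-n)),
    HomH.comp_assoc (zero_add (-j)) (show -j + -i = -n by omega) _ (zero_add (-n)),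
    A.resConj_whisker_comp P Q R _ (show -j + -i = -n by omega), LinearMap.map_smul,
    neg_mul_neg]

theorem zeta_mem_gradedCenter {i : ℤ} (σ : Ext P A.trivial i) :
    A.zeta P Q i σ ∈ Ext.gradedCenter Q i := by
  intro j n hji hij b
  have e : Ext.mul Q Q hij (A.zeta P Q i σ) b =
      (-1 : k) ^ (i * j) • Ext.mul Q Q hji b (A.zeta P Q i σ) :=
    A.actLeft_eq_actRight P Q Q hij σ b
  rw [e, smul_smul, mul_comm j i, neg_one_zpow_mul_self, one_smul]

/-- The map `ζ_k` is the identity of `Ext_A(k, k)`. -/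
theorem zeta_trivial {i : ℤ} (σ : Ext P A.trivial i) : A.zeta P P i σ = σ := by
  obtain ⟨σ, rfl⟩ := (Ext.equiv P P i).surjective σ
  obtain ⟨ψ, rfl⟩ := HomH.mk_surjective σ
  let πc : HomH P.F A.trivial 0 := HomH.mk _ _ 0 ⟨P.π, P.quasiIso.mem⟩
  let ρ : HomH (A.tensor P.F P.F) P.F 0 :=
    HomH.mk _ _ 0 ⟨A.rightResMap P.π P.F, A.rightResMap_mem P.F P.quasiIso.mem⟩
  have hρ : HomH.comp (zero_add 0) πc (A.resClass P P) = HomH.comp (zero_add 0) πc ρ :=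
    congrArg (HomH.mk _ _ 0) (Subtype.ext (A.comp_resMap_eq_comp_rightResMap P.π))
  have hρη : HomH.comp (zero_add 0) ρ (A.resInv P P) = HomH.id P.F := by
    apply (liftEquiv P.semifree P.quasiIso 0).injective
    rw [liftEquiv_apply, liftEquiv_apply]
    change HomH.comp _ πc _ = HomH.comp _ πc _
    rw [← HomH.comp_assoc (zero_add 0) (zero_add 0) (zero_add 0) (zero_add 0), ← hρ,
      HomH.comp_assoc (zero_add 0) (zero_add 0) (zero_add 0) (zero_add 0),
      show HomH.comp (zero_add 0) (A.resClass P P) (A.resInv P P) = HomH.id P.F from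
        A.resMap_comp_resInv P P]
  have hρψ : HomH.comp (zero_add (-i)) ρ (HomH.whisker A P.F (-i) (HomH.mk _ _ (-i) ψ)) =
      HomH.comp (add_zero (-i)) (HomH.mk _ _ (-i) ψ) ρ :=
    congrArg (HomH.mk _ _ (-i)) (Subtype.ext (A.rightResMap_comp_whisker ψ.1))
  simp only [zeta, LinearEquiv.coe_coe, LinearMap.comp_apply, LinearEquiv.symm_apply_apply]
  simp only [Ext.equiv, liftEquiv_apply]
  change HomH.comp _ πc _ = HomH.comp _ πc _
  rw [resConj_apply, ← HomH.comp_assoc (zero_add 0) (zero_add (-i)) (zero_add (-i)) (zero_add (-i)),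
    hρ, HomH.comp_assoc (zero_add 0) (zero_add (-i)) (zero_add (-i)) (zero_add (-i)),
    ← HomH.comp_assoc (zero_add (-i)) (add_zero (-i)) (add_zero (-i)) (zero_add (-i)), hρψ,
    HomH.comp_assoc (add_zero (-i)) (zero_add 0) (add_zero (-i)) (add_zero (-i)), hρη]
  rfl

theorem isGradedCommutative_ext_trivial : Ext.IsGradedCommutative P := by
  intro i j n hij hji σ τ
  have h := A.zeta_mem_gradedCenter P P τ i n hij hji σ
  rwa [A.zeta_trivial P τ] at h

end Zeta

end DGHopf

end DG

theorem proposition4p4 {k : Type u} [Field k] (A : DG.DGHopf.{u, v} k)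
    (U : DG.DGModule.{u, v, x₁} A.toDGAlgebra) (V : DG.DGModule.{u, v, x₂} A.toDGAlgebra)
    (P : DG.SemifreeResolution.{u, v, u, y₁} A.trivial)
    (Q : DG.SemifreeResolution.{u, v, x₂, y₂} V)
    (R : DG.SemifreeResolution.{u, v, x₁, y₃} U) :
    DG.Ext.IsGradedCommutative P ∧
    (∀ (i : ℤ) (σ : DG.Ext P A.trivial i), A.zeta P Q i σ ∈ DG.Ext.gradedCenter Q i) ∧
    (∀ (i j n : ℤ) (h : i + j = n) (σ : DG.Ext P A.trivial i) (μ : DG.Ext R V j),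
      A.actLeft P Q R h σ μ = A.actRight P R h σ μ) := by
  exact ⟨A.isGradedCommutative_ext_trivial P, fun _ σ => A.zeta_mem_gradedCenter P Q σ,
    fun _ _ _ h σ μ => A.actLeft_eq_actRight P Q R h σ μ⟩
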